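/- Let $\Bbbk$ be a field and let $\mathscr{C}$ be a fiat category over $\Bbbk$: an additive $\Bbbk$-linear $2$-category with finitely many objects and with a weak involution $*$ (identity on objects, reversing $1$- and $2$-morphisms, with $f^{**}\cong f$), such that every category $\mathscr{C}(\mathtt{i},\mathtt{j})$ is additive with split idempotents, has finitely many isomorphism classes of indecomposable objects and finite-dimensional morphism spaces, composition is $\Bbbk$-bilinear, each identity $1$-morphism $\mathbb{1}_{\mathtt{i}}$ is indecomposable, and for every $1$-morphism $f\in\mathscr{C}(\mathtt{i},\mathtt{j})$ there are $2$-morphisms $f\circ f^*\to\mathbb{1}_{\mathtt{j}}$ and $\mathbb{1}_{\mathtt{i}}\to f^*\circ f$ making $(f,f^*)$ an adjoint pair. For indecomposable $1$-morphisms $f,g$ write $f\le_R g$ if $g$ is a direct summand of $h\circ f$ for some $1$-morphism $h$, and $f\le_L g$ if $g$ is a direct summand of $f\circ h$ for some $1$-morphism $h$; the right cell $\mathcal{R}_g$ of $g$ consists of those $f$ with $f\le_R g$ and $g\le_R f$. For objects $\mathtt{i},\mathtt{j}$ let $\overline{\mathbf{P}}_{\mathtt{i}}(\mathtt{j})$ be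 the category whose objects are the morphisms $a:X\to Y$ of $\mathscr{C}(\mathtt{i},\mathtt{j})$ and whose morphisms from $a:X\to Y$ to $a':X'\to Y'$ are the commutative squares $(b:X\to X',\,b':Y\to Y')$ modulo those for which $b'$ factors as $b'=a'c$ for some $c:Y\to X'$; a $1$-morphism $f\in\mathscr{C}(\mathtt{j},\mathtt{k})$ acts as a functor $\overline{\mathbf{P}}_{\mathtt{i}}(\mathtt{j})\to\overline{\mathbf{P}}_{\mathtt{i}}(\mathtt{k})$ by applying $f\circ{-}$ component-wise. For an indecomposable $f\in\mathscr{C}(\mathtt{i},\mathtt{j})$ let $P_f=(0\to f)\in\overline{\mathbf{P}}_{\mathtt{i}}(\mathtt{j})$. Then each $P_f$ has a simple quotient $L_f$, unique up to isomorphism, and for indecomposable $1$-morphisms, whenever the expressions are defined, the following hold. (a) $f\,L_g\neq 0$ if and only if $f^*\le_L g$. (b) If the composition multiplicity $[f\,L_g:L_h]$ is nonzero, then $h\le_R g$. (c) If $h\le_R g$, then there is an indecomposable $1$-morphism $f$ with $[f\,L_g:L_h]\neq 0$. (d) If $L_f$ occurs in the top or in the socle of $h\,L_g$, then $f\in\mathcal{R}_g$.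 (e) For every indecomposable $f\in\mathscr{C}(\mathtt{i},\mathtt{j})$ there is a nonzero homomorphism $P_{\mathbb{1}_{\mathtt{i}}}\to f^*L_f$; in particular $f^*L_f\neq 0$. Moreover $\mathrm{Hom}(P_{\mathbb{1}_{\mathtt{i}}},f^*L_f)\cong\mathrm{End}(L_f)$ as $\Bbbk$-vector spaces; if $\Bbbk$ is algebraically closed, this space is one-dimensional, that is, the nonzero homomorphism is unique up to a scalar. -/

import Mathlib

open CategoryTheory CategoryTheory.Limits Bicategory Opposite

universe w v u

noncomputable section

namespace Fiat

section TwoCategories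

/-- An additive 2-category: every category of 1-morphisms `i ⟶ j` is additive (it has a zero
object and binary direct sums), and horizontal composition is biadditive on 2-morphisms.
Strictness of the associativity of 1-morphisms is not imposed: a (strict) 2-category is a special
bicategory. In Mathlib's order, `f ≫ g` is the composite `g ∘ f`. -/
class AdditiveTwoCategory (B : Type u) [Bicategory.{w, v} B] where
  preadditive : ∀ i j : B, Preadditive (i ⟶ j)
  hasZeroObject : ∀ i j : B, HasZeroObject (i ⟶ j)
  hasBinaryBiproducts : ∀ i j : B, HasBinaryBiproducts (i ⟶ j)
  add_whiskerRight : ∀ {i j k : B} {f g : i ⟶ j} (α β : f ⟶ g) (h : j ⟶ k),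
    (α + β) ▷ h = α ▷ h + β ▷ h
  whiskerLeft_add : ∀ {i j k : B} (h : i ⟶ j) {f g : j ⟶ k} (α β : f ⟶ g),
    h ◁ (α + β) = h ◁ α + h ◁ β

attribute [reducible, instance] AdditiveTwoCategory.preadditive

attribute [instance] AdditiveTwoCategory.hasZeroObject
  AdditiveTwoCategory.hasBinaryBiproducts

/-- A `𝕜`-linear additive 2-category: the spaces of 2-morphisms are `𝕜`-vector spaces and both
vertical and horizontal composition are `𝕜`-bilinear. -/
class LinearTwoCategory (𝕜 : Type*) [Field 𝕜] (B : Type u) [Bicategory.{w, v} B]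
    [AdditiveTwoCategory B] where
  linear : ∀ i j : B, Linear 𝕜 (i ⟶ j)
  smul_whiskerRight : ∀ {i j k : B} {f g : i ⟶ j} (c : 𝕜) (α : f ⟶ g) (h : j ⟶ k),
    (c • α) ▷ h = c • (α ▷ h)
  whiskerLeft_smul : ∀ {i j k : B} (h : i ⟶ j) {f g : j ⟶ k} (c : 𝕜) (α : f ⟶ g),
    h ◁ (c • α) = c • (h ◁ α)

attribute [reducible, instance] LinearTwoCategory.linear

/-- A weak involution `*` on a 2-category: it fixes the objects, reverses 1-morphisms and
2-morphisms, is compatible with identities and composition of 1-morphisms up to (natural)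
invertible 2-morphisms, and its square is naturally isomorphic to the identity. No further
coherence condition on these isomorphisms is required. -/
class WeakInvolution (B : Type u) [Bicategory.{w, v} B] where
  /-- the action on 1-morphisms and 2-morphisms -/
  starFunctor : ∀ i j : B, (i ⟶ j)ᵒᵖ ⥤ (j ⟶ i)
  starId : ∀ i : B, (starFunctor i i).obj (op (𝟙 i)) ≅ 𝟙 i
  starComp : ∀ {i j k : B} (f : i ⟶ j) (g : j ⟶ k),
    (starFunctor i k).obj (op (f ≫ g)) ≅
      (starFunctor j k).obj (op g) ≫ (starFunctor i j).obj (op f)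
  starComp_naturality_left : ∀ {i j k : B} {f f' : i ⟶ j} (α : f ⟶ f') (g : j ⟶ k),
    (starFunctor i k).map (α ▷ g).op ≫ (starComp f g).hom =
      (starComp f' g).hom ≫ (starFunctor j k).obj (op g) ◁ (starFunctor i j).map α.op
  starComp_naturality_right : ∀ {i j k : B} (f : i ⟶ j) {g g' : j ⟶ k} (β : g ⟶ g'),
    (starFunctor i k).map (f ◁ β).op ≫ (starComp f g).hom =
      (starComp f g').hom ≫ (starFunctor j k).map β.op ▷ (starFunctor i j).obj (op f)
  starStar : ∀ {i j : B} (f : i ⟶ j),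
    (starFunctor j i).obj (op ((starFunctor i j).obj (op f))) ≅ f
  starStar_naturality : ∀ {i j : B} {f f' : i ⟶ j} (α : f ⟶ f'),
    (starFunctor j i).map ((starFunctor i j).map α.op).op ≫ (starStar f').hom =
      (starStar f).hom ≫ α

/-- The 1-morphism `f*`. -/
abbrev dual {B : Type u} [Bicategory.{w, v} B] [WeakInvolution B] {i j : B} (f : i ⟶ j) : j ⟶ i :=
  (WeakInvolution.starFunctor i j).obj (op f)

/-- A fiat category over the field `𝕜`: a `𝕜`-linear additive 2-category with a weak involution,
with finitely many objects, whose categories of 1-morphisms are fully additive (idempotents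
split) with finitely many isomorphism classes of indecomposables and finite-dimensional spaces of
2-morphisms, whose identity 1-morphisms are indecomposable, and in which `(f, f*)` is an adjoint
pair for every 1-morphism `f`. -/
class FiatCategory (𝕜 : Type*) [Field 𝕜] (B : Type u) [Bicategory.{w, v} B]
    [AdditiveTwoCategory B] [LinearTwoCategory 𝕜 B] [WeakInvolution B] : Prop where
  finite_objects : Finite B
  isIdempotentComplete : ∀ i j : B, IsIdempotentComplete (i ⟶ j)
  finite_indecomposables : ∀ i j : B, ∃ S : Set (i ⟶ j), S.Finite ∧
    ∀ f : i ⟶ j, Indecomposable f → ∃ g ∈ S, Nonempty (f ≅ g)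
  finiteDimensional : ∀ {i j : B} (f g : i ⟶ j), FiniteDimensional 𝕜 (f ⟶ g)
  indecomposable_id : ∀ i : B, Indecomposable (𝟙 i)
  adjunction : ∀ {i j : B} (f : i ⟶ j), Nonempty (f ⊣ dual f)

end TwoCategories

section Cells

variable {B : Type u} [Bicategory.{w, v} B] [AdditiveTwoCategory B]

/-- `g` occurs as a direct summand of `f`. -/
def IsSummand {i j : B} (g f : i ⟶ j) : Prop :=
  ∃ y : i ⟶ j, Nonempty (f ≅ g ⊞ y)

/-- `f ≤_R g`: there is a 1-morphism `h` such that `g` is a direct summand of `h ∘ f`. This is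
possible only if `f` and `g` have the same source. -/
def LeR {i j l : B} (f : i ⟶ j) (g : i ⟶ l) : Prop :=
  ∃ h : j ⟶ l, IsSummand g (f ≫ h)

/-- `f ≤_L g`: there is a 1-morphism `h` such that `g` is a direct summand of `f ∘ h`. This is
possible only if `f` and `g` have the same target. -/
def LeL {i k j : B} (f : i ⟶ j) (g : k ⟶ j) : Prop :=
  ∃ h : k ⟶ i, IsSummand g (h ≫ f)

/-- `f` belongs to the right cell of `g`. -/
def MemRightCell {i j l : B} (f : i ⟶ j) (g : i ⟶ l) : Prop :=
  LeR f g ∧ LeR g f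

end Cells

section Abelianization

variable {V W : Type*} [Category* V] [Category* W] [Preadditive V] [Preadditive W]

instance arrowHomModule (𝕜 : Type*) [Semiring 𝕜] [Linear 𝕜 V] (a b : Arrow V) :
    Module 𝕜 (a ⟶ b) where
  smul c φ := Arrow.homMk (c • φ.left) (c • φ.right) (by simp)
  one_smul φ := by ext <;> exact one_smul _ _
  mul_smul c d φ := by ext <;> exact mul_smul _ _ _
  smul_zero c := by ext <;> exact smul_zero _
  smul_add c φ ψ := by ext <;> exact smul_add _ _ _
  add_smul c d φ := by ext <;> exact add_smul _ _ _
  zero_smul φ := by ext <;> exact zero_smul _ _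

instance arrowLinear (𝕜 : Type*) [Semiring 𝕜] [Linear 𝕜 V] : Linear 𝕜 (Arrow V) where
  smul_comp a b c r φ ψ := by ext <;> exact Linear.smul_comp _ _ _ _ _ _
  comp_smul a b c φ r ψ := by ext <;> exact Linear.comp_smul _ _ _ _ _ _

/-- The `𝕜`-linear structure on the abelianization of a `𝕜`-linear category. -/
instance freydLinear (𝕜 : Type*) [Semiring 𝕜] [Linear 𝕜 V] : Linear 𝕜 (Preadditive.RightFreyd V) :=
  letI : Preadditive (CategoryTheory.Quotient (Arrow.rightHomotopic V)) :=
    inferInstanceAs (Preadditive (Preadditive.RightFreyd V))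
  haveI : (CategoryTheory.Quotient.functor (Arrow.rightHomotopic V)).Additive :=
    inferInstanceAs (Preadditive.RightFreyd.quotient V).Additive
  CategoryTheory.Quotient.linear 𝕜 (Arrow.rightHomotopic V) (by
    rintro c a b φ ψ ⟨h⟩
    exact ⟨⟨c • h.hom, by
      change c • φ.right - c • ψ.right = _
      rw [← smul_sub, h.comm, Linear.smul_comp]⟩⟩)

/-- The component-wise action of an additive functor on abelianizations. -/
def freydMap (F : V ⥤ W) [F.Additive] : Preadditive.RightFreyd V ⥤ Preadditive.RightFreyd W :=
  CategoryTheory.Quotient.lift (Arrow.rightHomotopic V) (F.mapArrow ⋙ Preadditive.RightFreyd.quotient W) (by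
    rintro a b φ ψ ⟨h⟩
    refine Preadditive.RightFreyd.eq_of_rightHomotopy _ _ ⟨F.map h.hom, ?_⟩
    change F.map φ.right - F.map ψ.right = F.map h.hom ≫ F.map b.hom
    rw [← F.map_sub, h.comm, F.map_comp])

end Abelianization

section Simples

variable {A : Type*} [Category* A] [Preadditive A]

/-- `IsCompositionSeries M l`: the object `M` has a composition series whose successive simple
subquotients, from the top to the bottom, are the members of the list `l`. -/
inductive IsCompositionSeries : A → List A → Prop
  | zero (M : A) (hM : IsZero M) : IsCompositionSeries M []
  | cons (S : ShortComplex A) (hS : S.ShortExact) (hX : Simple S.X₃) (l : List A)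
      (hl : IsCompositionSeries S.X₁ l) : IsCompositionSeries S.X₂ (S.X₃ :: l)

open Classical in
/-- The composition multiplicity `[M : L]`: the number of subquotients isomorphic to `L` in a
composition series of `M`. -/
def multiplicity (M L : A) : ℕ :=
  sSup {n | ∃ l : List A, IsCompositionSeries M l ∧
    n = l.countP (fun X => decide (Nonempty (X ≅ L)))}

/-- A semisimple object: a finite direct sum of simple objects. -/
def IsSemisimple (T : A) : Prop :=
  ∃ (n : ℕ) (X : Fin n → A) (b : Bicone X),
    (∀ a, Simple (X a)) ∧ Nonempty b.IsBilimit ∧ Nonempty (T ≅ b.pt)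

/-- `q : M ⟶ T` is the top of `M`, that is, its largest semisimple quotient. -/
def IsTop {M T : A} (q : M ⟶ T) : Prop :=
  Epi q ∧ IsSemisimple T ∧
    ∀ (S : A) (r : M ⟶ S), IsSemisimple S → ∃ t : T ⟶ S, q ≫ t = r

/-- `s : T ⟶ M` is the socle of `M`, that is, its largest semisimple subobject. -/
def IsSocle {T M : A} (s : T ⟶ M) : Prop :=
  Mono s ∧ IsSemisimple T ∧
    ∀ (S : A) (r : S ⟶ M), IsSemisimple S → ∃ t : S ⟶ T, t ≫ s = r

/-- The simple object `L` occurs in the top of `M`: it is a direct summand of the top. -/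
def OccursInTop (L M : A) : Prop :=
  ∃ (T : A) (q : M ⟶ T), IsTop q ∧ Nonempty (Retract L T)

/-- The simple object `L` occurs in the socle of `M`: it is a direct summand of the socle. -/
def OccursInSocle (L M : A) : Prop :=
  ∃ (T : A) (s : T ⟶ M), IsSocle s ∧ Nonempty (Retract L T)

end Simples

section Principal

variable {B : Type u} [Bicategory.{w, v} B] [AdditiveTwoCategory B]

instance postcomp_additive (i : B) {j k : B} (f : j ⟶ k) : (postcomp i f).Additive where
  map_add {_ _ α β} := AdditiveTwoCategory.add_whiskerRight α β f

/-- The value at `j` of the `i`-th principal 2-representation: the abelianization of the category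
of 1-morphisms from `i` to `j`. Its objects are the 2-morphisms `a : x ⟶ y` between 1-morphisms
from `i` to `j`, and its morphisms are the commutative squares `(b, b')` from `a` to `a'`, two of
them being identified if the difference of their components `b'` factors through `a'`. -/
abbrev Principal (i j : B) := Preadditive.RightFreyd (i ⟶ j)

/-- The action of a 1-morphism `f : j ⟶ k` on the `i`-th principal 2-representation, which is the
component-wise application of `f ∘ -`. -/
abbrev act {i j k : B} (f : j ⟶ k) : Principal i j ⥤ Principal i k :=
  freydMap (postcomp i f)

/-- The projective object `P_f`, which is the arrow `0 ⟶ f`. -/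
abbrev proj {i j : B} (f : i ⟶ j) : Principal i j :=
  (Preadditive.RightFreyd.functor (i ⟶ j)).obj f

/-- `L` is a simple quotient of `P_f`; for indecomposable `f` this says that `L` is (a copy of)
the simple object `L_f`. -/
def IsSimpleQuotient {i j : B} (f : i ⟶ j) (L : Principal i j) : Prop :=
  Simple L ∧ ∃ p : proj f ⟶ L, Epi p

end Principal

end Fiat

end

/-! Everything follows from one equivalence: for indecomposable `g`, there is a nonzero morphism
`P_x ⟶ f L_g` if and only if `g` is a direct summand of `f* ∘ x`
(`exists_proj_hom_act_ne_zero_iff`). Since `f** ≅ f`, the functor of `f*` is left adjoint to that of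
`f`, so such morphisms correspond to morphisms `P_{f* ∘ x} ⟶ L_g`. As `P_g` is projective with local
endomorphism ring, one of these is nonzero exactly when `P_g` splits off `P_{f* ∘ x}`.

Letting `x` vary gives (a), because the `P_x` detect zero objects. For `x = h` it gives (b), because
`[M : L_h] ≠ 0` means that `P_h` maps nontrivially to `M` (`multiplicity_ne_zero_iff`). Statement
(c) is the converse with `f` replaced by an indecomposable summand. For (d), a quotient or subobject
`L_f` of `h L_g` gives one inequality directly and the other after transposing along `h ⊣ h*` or `h*
⊣ h`. For (e), `Hom(P_𝟙, f* L_f) ≅ Hom(P_f, L_f) ≅ End(L_f)`.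

The groundwork makes this meaningful. Finitely many indecomposables and finite-dimensional morphism
spaces provide an additive generator `G`; hence weak kernels exist and the Freyd category is abelian
(`freydAbelian`). The dimension of `Hom(P_G, M)` is additive on short exact sequences and positive
on nonzero objects, so all objects have finite length. -/

noncomputable section

namespace Fiat

/-! ### Fitting's lemma. -/

section FiniteDimensionalAlgebra

/-- Fitting's lemma for a finite-dimensional algebra without nontrivial idempotents. -/
lemma isUnit_or_isNilpotent_of_idempotents {𝕜 E : Type*} [Field 𝕜] [Ring E] [Algebra 𝕜 E]
    [FiniteDimensional 𝕜 E] (hE : ∀ p : E, p * p = p → p = 0 ∨ p = 1) (x : E) :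
    IsUnit x ∨ IsNilpotent x := by
  have hx : IsIntegral 𝕜 x := Algebra.IsIntegral.isIntegral x
  obtain ⟨q, hq, hXq⟩ := Polynomial.exists_eq_pow_rootMultiplicity_mul_and_not_dvd (minpoly 𝕜 x)
    (minpoly.ne_zero hx) 0
  set n := (minpoly 𝕜 x).rootMultiplicity 0
  simp only [Polynomial.C_0, sub_zero] at hq hXq
  have hcop : IsCoprime (Polynomial.X ^ n) q :=
    ((Polynomial.prime_X.irreducible.coprime_iff_not_dvd).mpr hXq).pow_left
  obtain ⟨a, b, hab⟩ := hcop
  have hzero : Polynomial.aeval x (Polynomial.X ^ n * q) = 0 := by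
    rw [← hq]; exact minpoly.aeval 𝕜 x
  -- With `minpoly = X ^ n * q` and the Bézout relation `a * X ^ n + b * q = 1`, the value of `P` at
  -- `x` is the idempotent projecting onto the part where `x` is invertible. If it is `0`, then `x ^
  -- n = 0`; if it is `1` and `n > 0`, then `a * X ^ (n - 1)` gives the inverse.
  set P : Polynomial 𝕜 := a * Polynomial.X ^ n
  have hidem : Polynomial.aeval x P * Polynomial.aeval x P = Polynomial.aeval x P := by
    rw [← map_mul, ← sub_eq_zero, ← map_sub]
    have : P * P - P = -(a * b) * (Polynomial.X ^ n * q) := by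
      linear_combination P * hab
    rw [this, map_mul, hzero, mul_zero]
  rcases hE _ hidem with h0 | h1
  · right
    refine ⟨n, ?_⟩
    have : (Polynomial.X ^ n : Polynomial 𝕜) = Polynomial.X ^ n * P + b * (Polynomial.X ^ n * q) := by
      linear_combination - Polynomial.X ^ n * hab
    have h := congrArg (Polynomial.aeval x) this
    rw [map_add, map_mul _ _ P, map_mul _ b, h0, hzero, mul_zero, mul_zero, add_zero] at h
    simpa using h
  · rcases Nat.eq_zero_or_pos n with hn | hn
    · left
      have hc : (minpoly 𝕜 x).coeff 0 ≠ 0 := by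
        intro h
        apply hXq
        rw [hn, pow_zero, one_mul] at hq
        rw [← hq, Polynomial.X_dvd_iff, h]
      have hdecomp := congrArg (Polynomial.aeval x) (Polynomial.divX_mul_X_add (minpoly 𝕜 x))
      rw [minpoly.aeval, map_add, map_mul, Polynomial.aeval_X, Polynomial.aeval_C] at hdecomp
      set c := (minpoly 𝕜 x).coeff 0
      set y := Polynomial.aeval x (minpoly 𝕜 x).divX
      have hcomm : y * x = x * y := by
        have := congrArg (Polynomial.aeval x)
          (mul_comm (minpoly 𝕜 x).divX (Polynomial.X : Polynomial 𝕜))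
        simpa [y] using this
      have hyx : y * x = - algebraMap 𝕜 E c := eq_neg_of_add_eq_zero_left hdecomp
      have hinv : algebraMap 𝕜 E (c⁻¹) * algebraMap 𝕜 E c = 1 := by
        rw [← map_mul, inv_mul_cancel₀ hc, map_one]
      refine ⟨⟨x, -(algebraMap 𝕜 E c⁻¹ * y), ?_, ?_⟩, rfl⟩
      · rw [mul_neg, ← mul_assoc, ← Algebra.commutes, mul_assoc, ← hcomm, hyx, mul_neg, hinv,
          neg_neg]
      · rw [neg_mul, mul_assoc, hyx, mul_neg, hinv, neg_neg]
    · left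
      obtain ⟨m, hm⟩ : ∃ m, n = m + 1 := ⟨n - 1, by omega⟩
      have e1 : Polynomial.aeval x (a * Polynomial.X ^ m) * x = 1 := by
        rw [← h1]; simp [P, hm, pow_succ, mul_assoc]
      have e2 : x * Polynomial.aeval x (a * Polynomial.X ^ m) = 1 := by
        rw [← h1]
        have : P = Polynomial.X * (a * Polynomial.X ^ m) := by
          simp only [P, hm]; ring
        rw [this, map_mul _ Polynomial.X, Polynomial.aeval_X]
      exact ⟨⟨x, _, e2, e1⟩, rfl⟩

end FiniteDimensionalAlgebra

/-! ### Decomposition into indecomposables and weak kernels. -/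

section KrullSchmidt

variable {V : Type*} [Category* V] [Preadditive V] [HasBinaryBiproducts V]

/-- The complement of a retract is obtained by splitting the idempotent `𝟙 X - e ≫ i`. -/
lemma nonempty_iso_biprod_of_idempotent [IsIdempotentComplete V] {X Y : V}
    {i : Y ⟶ X} {e : X ⟶ Y} (hie : i ≫ e = 𝟙 Y) :
    ∃ (Z : V) (j : Z ⟶ X) (d : X ⟶ Z) (φ : X ≅ Y ⊞ Z), j ≫ d = 𝟙 Z ∧ e ≫ i + d ≫ j = 𝟙 X ∧
      φ.hom = biprod.lift e d ∧ φ.inv = biprod.desc i j := by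
  obtain ⟨Z, j, d, hjd, hdj⟩ := IsIdempotentComplete.idempotents_split X (𝟙 X - e ≫ i) (by
    simp [reassoc_of% hie])
  have hid : i ≫ d = 0 := by
    have h : (i ≫ d) ≫ j = 0 := by
      rw [Category.assoc, hdj]; simp [reassoc_of% hie]
    simpa [hjd] using h =≫ d
  have hje : j ≫ e = 0 := by
    have h : d ≫ j ≫ e = 0 := by
      rw [reassoc_of% hdj]; simp [hie]
    have := j ≫= h
    simpa [reassoc_of% hjd] using this
  have htot : e ≫ i + d ≫ j = 𝟙 X := by rw [hdj]; abel
  refine ⟨Z, j, d, ⟨biprod.lift e d, biprod.desc i j, by simpa using htot, ?_⟩, hjd, htot, rfl, rfl⟩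
  ext <;> simp [hie, hid, hje, hjd]

lemma idempotent_eq_zero_or_one_of_indecomposable [IsIdempotentComplete V] {X : V}
    (hX : Indecomposable X) (p : X ⟶ X) (hp : p ≫ p = p) : p = 0 ∨ p = 𝟙 X := by
  obtain ⟨Y, i, e, hie, hei⟩ := IsIdempotentComplete.idempotents_split X p hp
  obtain ⟨Z, j, d, φ, -, htot, -, -⟩ := nonempty_iso_biprod_of_idempotent hie
  rcases hX.2 Y Z φ with hY | hZ
  · left
    rw [← hei, hY.eq_of_tgt e 0, zero_comp]
  · right
    rw [hei, hZ.eq_of_tgt d 0, zero_comp, add_zero] at htot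
    exact htot

variable (𝕜 : Type*) [Field 𝕜] [Linear 𝕜 V] [∀ X Y : V, FiniteDimensional 𝕜 (X ⟶ Y)]

include 𝕜 in
/-- The endomorphism ring of an indecomposable object is local. -/
lemma isUnit_or_isNilpotent_of_indecomposable [IsIdempotentComplete V] {X : V}
    (hX : Indecomposable X) (x : End X) : IsUnit x ∨ IsNilpotent x :=
  have : FiniteDimensional 𝕜 (End X) := inferInstanceAs (FiniteDimensional 𝕜 (X ⟶ X))
  isUnit_or_isNilpotent_of_idempotents (𝕜 := 𝕜)
    (idempotent_eq_zero_or_one_of_indecomposable hX) x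

/-- Block-diagonal matrices embed `End Y × End Z` into `End X`, and `End Z` is nonzero. This is the
decreasing measure for `indecomposable_induction`. -/
lemma finrank_end_lt_of_iso_biprod {X Y Z : V} (φ : X ≅ Y ⊞ Z) (hZ : ¬ IsZero Z) :
    Module.finrank 𝕜 (Y ⟶ Y) < Module.finrank 𝕜 (X ⟶ X) := by
  let f : (Y ⟶ Y) × (Z ⟶ Z) →ₗ[𝕜] (X ⟶ X) :=
    { toFun := fun p => φ.hom ≫ biprod.map p.1 p.2 ≫ φ.inv
      map_add' := fun p q => by
        rw [← Preadditive.comp_add, ← Preadditive.add_comp]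
        congr 2
        ext <;> simp
      map_smul' := fun c p => by
        rw [RingHom.id_apply, ← Linear.comp_smul, ← Linear.smul_comp]
        congr 2
        ext <;> simp }
  have hf : Function.Injective f := by
    intro p q h
    have h' : biprod.map p.1 p.2 = biprod.map q.1 q.2 := by
      have := φ.inv ≫= h =≫ φ.hom
      simpa [f] using this
    ext1
    · simpa using biprod.inl ≫= h' =≫ biprod.fst
    · simpa using biprod.inr ≫= h' =≫ biprod.snd
  have hle := LinearMap.finrank_le_finrank_of_injective hf
  rw [Module.finrank_prod] at hle
  have hnt : Nontrivial (Z ⟶ Z) := ⟨𝟙 Z, 0, fun h => hZ ((IsZero.iff_id_eq_zero Z).2 h)⟩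
  have := Module.finrank_pos (R := 𝕜) (M := Z ⟶ Z)
  omega

include 𝕜 in
/-- In a Hom-finite category every object is a finite direct sum of indecomposable ones. -/
theorem indecomposable_induction {Q : V → Prop} (hzero : ∀ X, IsZero X → Q X)
    (hind : ∀ X, Indecomposable X → Q X)
    (hbiprod : ∀ X Y Z, (X ≅ Y ⊞ Z) → Q Y → Q Z → Q X) (X : V) : Q X := by
  induction hn : Module.finrank 𝕜 (X ⟶ X) using Nat.strong_induction_on generalizing X with
  | _ n ih =>
    subst hn
    by_cases h0 : IsZero X
    · exact hzero X h0
    by_cases hX : Indecomposable X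
    · exact hind X hX
    · obtain ⟨Y, Z, φ, hY, hZ⟩ : ∃ (Y Z : V) (_ : X ≅ Y ⊞ Z), ¬ IsZero Y ∧ ¬ IsZero Z := by
        by_contra! h
        refine hX ⟨h0, fun Y Z φ => ?_⟩
        by_cases hY : IsZero Y
        · exact Or.inl hY
        · exact Or.inr (h Y Z φ hY)
      exact hbiprod X Y Z φ
        (ih _ (finrank_end_lt_of_iso_biprod 𝕜 φ hZ) Y rfl)
        (ih _ (finrank_end_lt_of_iso_biprod 𝕜 (φ ≪≫ biprod.braiding Y Z) hY) Z rfl)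

/-- `G` is an additive generator: every indecomposable object is a retract of it. -/
def IsAdditiveGenerator (G : V) : Prop :=
  ∀ X : V, Indecomposable X → Nonempty (Retract X G)

lemma exists_isAdditiveGenerator [HasZeroObject V]
    (h : ∃ S : Set V, S.Finite ∧ ∀ X : V, Indecomposable X → ∃ Y ∈ S, Nonempty (X ≅ Y)) :
    ∃ G : V, IsAdditiveGenerator G := by
  obtain ⟨S, hS, h⟩ := h
  have := hS.to_subtype
  have : HasFiniteProducts V := hasFiniteProducts_of_has_binary_and_terminal
  have : HasFiniteBiproducts V := HasFiniteBiproducts.of_hasFiniteProducts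
  refine ⟨⨁ fun s : S => (s : V), fun X hX => ?_⟩
  obtain ⟨Y, hY, ⟨φ⟩⟩ := h X hX
  exact ⟨⟨φ.hom ≫ biproduct.ι (fun s : S => (s : V)) ⟨Y, hY⟩,
    biproduct.π (fun s : S => (s : V)) ⟨Y, hY⟩ ≫ φ.inv, by simp⟩⟩

variable (V) in
/-- A category has weak kernels if every morphism `f` has a morphism `k` with `k ≫ f = 0` through
which all the morphisms annihilated by `f` factor. -/
class HasWeakKernels : Prop where
  exists_weakKernel : ∀ {X Y : V} (f : X ⟶ Y), ∃ (K : V) (k : K ⟶ X), k ≫ f = 0 ∧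
    ∀ {Z : V} (g : Z ⟶ X), g ≫ f = 0 → ∃ l : Z ⟶ K, l ≫ k = g

include 𝕜 in
-- A basis of the space of morphisms `G ⟶ X` killed by `f` assembles into a weak kernel from a power
-- of `G`. A test morphism from a retract of `G` factors by expansion in this basis; other sources
-- reduce to indecomposable ones.
lemma IsAdditiveGenerator.hasWeakKernels [HasZeroObject V] {G : V} (hG : IsAdditiveGenerator G) :
    HasWeakKernels V where
  exists_weakKernel {X Y} f := by
    have : HasFiniteProducts V := hasFiniteProducts_of_has_binary_and_terminal
    have : HasFiniteBiproducts V := HasFiniteBiproducts.of_hasFiniteProducts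
    let N : Submodule 𝕜 (G ⟶ X) := LinearMap.ker (Linear.rightComp 𝕜 G f)
    let b := Module.finBasis 𝕜 N
    let k : (⨁ fun _ : Fin (Module.finrank 𝕜 N) => G) ⟶ X :=
      biproduct.desc fun m => ((b m : N) : G ⟶ X)
    refine ⟨_, k, ?_, fun {Z} => ?_⟩
    · ext m
      have hm : ((b m : N) : G ⟶ X) ≫ f = 0 := (b m).2
      simp [k, hm]
    · refine indecomposable_induction 𝕜 (Q := fun Z => ∀ g : Z ⟶ X, g ≫ f = 0 → ∃ l, l ≫ k = g)
        ?_ ?_ ?_ Z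
      · intro Z hZ g _
        exact ⟨0, hZ.eq_of_src _ _⟩
      · intro Z hZ g hg
        obtain ⟨r⟩ := hG Z hZ
        have hmem : r.r ≫ g ∈ N := by simp [N, hg]
        have hsum := congrArg (Subtype.val) (b.sum_repr ⟨r.r ≫ g, hmem⟩)
        refine ⟨r.i ≫ biproduct.lift fun m => b.repr ⟨r.r ≫ g, hmem⟩ m • 𝟙 G, ?_⟩
        have : (biproduct.lift fun m => b.repr ⟨r.r ≫ g, hmem⟩ m • 𝟙 G) ≫ k = r.r ≫ g := by
          have hsum' := (AddSubmonoidClass.coe_finsetSum _ _).symm.trans hsum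
          refine Eq.trans ?_ hsum'
          simp [k, biproduct.lift_desc]
        rw [Category.assoc, this]
        simp
      · intro Z Z₁ Z₂ φ h₁ h₂ g hg
        obtain ⟨l₁, hl₁⟩ := h₁ (biprod.inl ≫ φ.inv ≫ g) (by simp [hg])
        obtain ⟨l₂, hl₂⟩ := h₂ (biprod.inr ≫ φ.inv ≫ g) (by simp [hg])
        refine ⟨φ.hom ≫ biprod.desc l₁ l₂, ?_⟩
        rw [Category.assoc, ← Iso.eq_inv_comp]
        ext <;> simp [hl₁, hl₂]

end KrullSchmidt

/-! ### The Freyd category: projectives, kernels, abelianness. -/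

section Freyd

open Preadditive

variable {V : Type*} [Category* V] [Preadditive V]

lemma freyd_obj_surjective (M : RightFreyd V) :
    ∃ a : Arrow V, (RightFreyd.quotient V).obj a = M :=
  ⟨M.as, rfl⟩

section Cover

variable [HasZeroObject V]

/-- The projective object of the Freyd category attached to an object of `V`. -/
abbrev freydProj (X : V) : RightFreyd V := (RightFreyd.functor V).obj X

/-- The morphism from `freydProj X` to the class of an arrow defined by a morphism from `X` to the
target of this arrow. -/
def freydElement (a : Arrow V) {X : V} (b : X ⟶ a.right) :
    freydProj X ⟶ (RightFreyd.quotient V).obj a :=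
  (RightFreyd.quotient V).map (Arrow.homMk 0 b ((isZero_zero V).eq_of_src _ _))

lemma freydElement_surjective (a : Arrow V) {X : V}
    (θ : freydProj X ⟶ (RightFreyd.quotient V).obj a) : ∃ b, freydElement a b = θ := by
  obtain ⟨φ, rfl⟩ := (RightFreyd.quotient V).map_surjective θ
  refine ⟨φ.right, (RightFreyd.quotient V).congr_map ?_⟩
  ext
  · exact (isZero_zero V).eq_of_src _ _
  · rfl

/-- With `freydElement_surjective`, this identifies the morphisms from `freydProj X` to the class of
`a` with the cokernel of composition with `a.hom` on morphisms out of `X`. -/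
lemma freydElement_eq_zero_iff (a : Arrow V) {X : V} (b : X ⟶ a.right) :
    freydElement a b = 0 ↔ ∃ c, c ≫ a.hom = b := by
  rw [freydElement, RightFreyd.quotient_map_eq_zero_iff]
  constructor
  · rintro ⟨h⟩
    exact ⟨h.hom, h.comm.symm.trans (sub_zero b)⟩
  · rintro ⟨c, hc⟩
    exact ⟨⟨c, (sub_zero b).trans hc.symm⟩⟩

lemma freydElement_comp {a a' : Arrow V} {X : V} (b : X ⟶ a.right) (f : a ⟶ a') :
    freydElement a b ≫ (RightFreyd.quotient V).map f = freydElement a' (b ≫ f.right) := by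
  rw [freydElement, ← Functor.map_comp]
  refine (RightFreyd.quotient V).congr_map ?_
  ext
  · exact (isZero_zero V).eq_of_src _ _
  · rfl

lemma functor_map_comp_freydElement (a : Arrow V) {X Y : V} (c : Y ⟶ X) (b : X ⟶ a.right) :
    (RightFreyd.functor V).map c ≫ freydElement a b = freydElement a (c ≫ b) := by
  rw [Functor.comp_map]
  exact freydElement_comp (a := (RightFreyd.rightFunctor V).obj X) c _

lemma freydElement_add (a : Arrow V) {X : V} (b b' : X ⟶ a.right) :
    freydElement a (b + b') = freydElement a b + freydElement a b' := by
  rw [freydElement, freydElement, freydElement, ← Functor.map_add]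
  refine (RightFreyd.quotient V).congr_map ?_
  ext
  · exact (isZero_zero V).eq_of_src _ _
  · rfl

/-- The canonical epimorphism onto the class of an arrow. -/
abbrev freydCover (a : Arrow V) : freydProj a.right ⟶ (RightFreyd.quotient V).obj a :=
  freydElement a (𝟙 a.right)

instance (a : Arrow V) : Epi (freydCover a) := by
  let φ : (RightFreyd.rightFunctor V).obj a.right ⟶ a :=
    Arrow.homMk 0 (𝟙 a.right) ((isZero_zero V).eq_of_src _ _)
  have : IsIso φ.right := inferInstanceAs (IsIso (𝟙 a.right))
  exact RightFreyd.epi_of_isIso_right φ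

lemma hom_comp_freydCover (a : Arrow V) :
    (RightFreyd.functor V).map a.hom ≫ freydCover a = 0 := by
  rw [functor_map_comp_freydElement, freydElement_eq_zero_iff]
  exact ⟨𝟙 _, by simp⟩

lemma exists_freydCover_comp (a : Arrow V) {N : RightFreyd V} (ψ : freydProj a.right ⟶ N)
    (hψ : (RightFreyd.functor V).map a.hom ≫ ψ = 0) : ∃ χ, freydCover a ≫ χ = ψ := by
  obtain ⟨n, rfl⟩ := freyd_obj_surjective N
  obtain ⟨b, rfl⟩ := freydElement_surjective n ψ
  rw [functor_map_comp_freydElement, freydElement_eq_zero_iff] at hψ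
  obtain ⟨c, hc⟩ := hψ
  refine ⟨(RightFreyd.quotient V).map (Arrow.homMk c b hc), ?_⟩
  rw [freydElement_comp]
  exact congrArg _ (Category.id_comp b)

/-- Every object is presented by projective objects. -/
lemma exists_presentation (M : RightFreyd V) :
    ∃ (X Y : V) (r : freydProj X ⟶ freydProj Y) (p : freydProj Y ⟶ M), Epi p ∧ r ≫ p = 0 ∧
      ∀ {N : RightFreyd V} (ψ : freydProj Y ⟶ N), r ≫ ψ = 0 → ∃ χ, p ≫ χ = ψ := by
  obtain ⟨a, rfl⟩ := freyd_obj_surjective M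
  exact ⟨_, _, _, freydCover a, inferInstance, hom_comp_freydCover a,
    exists_freydCover_comp a⟩

/-- The projective objects detect equality of morphisms. -/
lemma freyd_hom_ext {M N : RightFreyd V} {φ ψ : M ⟶ N}
    (h : ∀ (X : V) (θ : freydProj X ⟶ M), θ ≫ φ = θ ≫ ψ) : φ = ψ := by
  obtain ⟨X, Y, r, p, hp, -⟩ := exists_presentation M
  rw [← cancel_epi p]
  exact h Y p

variable [HasBinaryBiproducts V]

/-- The cokernel of `φ` is the class of `n.left ⊞ m.right ⟶ n.right`. If `b` vanishes there, it is a
morphism through `n.hom`, which is zero in `N`, plus one through `f.right`, which lifts. This yields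
both projectivity of `freydProj X` and normality of monomorphisms. -/
lemma exists_lift_of_forall_comp_eq_zero {M N : RightFreyd V} (φ : M ⟶ N) {X : V}
    (θ : freydProj X ⟶ N) (h : ∀ {T : RightFreyd V} (ψ : N ⟶ T), φ ≫ ψ = 0 → θ ≫ ψ = 0) :
    ∃ θ', θ' ≫ φ = θ := by
  obtain ⟨m, rfl⟩ := freyd_obj_surjective M
  obtain ⟨n, rfl⟩ := freyd_obj_surjective N
  obtain ⟨f, rfl⟩ := (RightFreyd.quotient V).map_surjective φ
  obtain ⟨b, rfl⟩ := freydElement_surjective n θ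
  have h0 := h ((RightFreyd.quotient V).map (RightFreyd.Candidate.π f))
    ((RightFreyd.Candidate.cokernelCofork f).condition)
  rw [freydElement_comp, freydElement_eq_zero_iff] at h0
  obtain ⟨c, hc⟩ := h0
  change X ⟶ n.left ⊞ m.right at c
  change c ≫ biprod.desc n.hom f.right = b ≫ 𝟙 _ at hc
  refine ⟨freydElement m (c ≫ biprod.snd), ?_⟩
  rw [freydElement_comp, ← sub_eq_zero]
  have hb : b = c ≫ biprod.fst ≫ n.hom + (c ≫ biprod.snd) ≫ f.right := by
    rw [← Category.comp_id b, ← hc, biprod.desc_eq]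
    simp
  have hz : freydElement n (c ≫ biprod.fst ≫ n.hom) = 0 :=
    (freydElement_eq_zero_iff _ _).2 ⟨c ≫ biprod.fst, by simp⟩
  rw [hb, freydElement_add, hz]
  simp

instance (X : V) : Projective (freydProj X) where
  factors θ φ _ := exists_lift_of_forall_comp_eq_zero φ θ fun ψ hψ => by
    rw [zero_of_epi_comp φ hψ, comp_zero]

end Cover

section Abelian

variable [HasBinaryBiproducts V]

lemma exists_weakPullback [HasWeakKernels V] {X Y S : V} (p : X ⟶ S) (q : Y ⟶ S) :
    ∃ (W : V) (w₁ : W ⟶ X) (w₂ : W ⟶ Y), w₁ ≫ p = w₂ ≫ q ∧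
      ∀ {Z : V} (z₁ : Z ⟶ X) (z₂ : Z ⟶ Y), z₁ ≫ p = z₂ ≫ q →
        ∃ l : Z ⟶ W, l ≫ w₁ = z₁ ∧ l ≫ w₂ = z₂ := by
  obtain ⟨W, k, hk, huniv⟩ := HasWeakKernels.exists_weakKernel (biprod.desc p (-q))
  refine ⟨W, k ≫ biprod.fst, k ≫ biprod.snd, ?_, fun z₁ z₂ h => ?_⟩
  · rw [biprod.desc_eq] at hk
    simpa [← sub_eq_add_neg, sub_eq_zero] using hk
  · obtain ⟨l, hl⟩ := huniv (biprod.lift z₁ z₂) (by simp [h])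
    exact ⟨l, by simp [reassoc_of% hl], by simp [reassoc_of% hl]⟩

instance freyd_hasKernels [HasWeakKernels V] : HasKernels (RightFreyd V) where
  has_limit {M N} φ := by
    obtain ⟨m, rfl⟩ := freyd_obj_surjective M
    obtain ⟨n, rfl⟩ := freyd_obj_surjective N
    obtain ⟨f, rfl⟩ := (RightFreyd.quotient V).map_surjective φ
    -- `K` collects the elements of `m.right` that die in the target, and `W` the relations among
    -- them coming from `m`; the kernel is the class of `w₁ : W ⟶ K`. The nonuniqueness of weak
    -- factorizations disappears modulo homotopy.
    obtain ⟨K, k₁, k₂, hk, hK⟩ := exists_weakPullback f.right n.hom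
    obtain ⟨W, w₁, w₂, hw, hW⟩ := exists_weakPullback k₁ m.hom
    let ι : Arrow.mk w₁ ⟶ m := Arrow.homMk w₂ k₁ hw.symm
    have hι : (RightFreyd.quotient V).map ι ≫ (RightFreyd.quotient V).map f = 0 := by
      rw [← Functor.map_comp, RightFreyd.quotient_map_eq_zero_iff]
      exact ⟨⟨k₂, by simpa [ι] using hk⟩⟩
    have hmono : Mono ((RightFreyd.quotient V).map ι) := by
      refine Preadditive.mono_of_cancel_zero _ fun {T} g hg => ?_
      obtain ⟨t, rfl⟩ := freyd_obj_surjective T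
      obtain ⟨g, rfl⟩ := (RightFreyd.quotient V).map_surjective g
      rw [← Functor.map_comp, RightFreyd.quotient_map_eq_zero_iff] at hg
      obtain ⟨h⟩ := hg
      obtain ⟨l, hl, -⟩ := hW g.right h.hom (by simpa [ι] using h.comm)
      rw [RightFreyd.quotient_map_eq_zero_iff]
      exact ⟨⟨l, by simpa using hl.symm⟩⟩
    refine ⟨⟨KernelFork.ofι _ hι, KernelFork.IsLimit.ofι' _ hι fun {T} g hg => ?_⟩⟩
    refine Classical.choice ?_
    obtain ⟨t, rfl⟩ := freyd_obj_surjective T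
    obtain ⟨g, rfl⟩ := (RightFreyd.quotient V).map_surjective g
    rw [← Functor.map_comp, RightFreyd.quotient_map_eq_zero_iff] at hg
    obtain ⟨h⟩ := hg
    obtain ⟨l, hl, -⟩ := hK g.right h.hom (by simpa using h.comm)
    obtain ⟨l', hl', hl''⟩ := hW (t.hom ≫ l) g.left (by simp [hl])
    refine ⟨(RightFreyd.quotient V).map (Arrow.homMk l' l hl'), ?_⟩
    rw [← Functor.map_comp]
    refine (RightFreyd.quotient V).congr_map ?_
    ext
    · simpa [ι] using hl''
    · simpa [ι] using hl

variable [HasZeroObject V]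

instance freyd_hasFiniteProducts : HasFiniteProducts (RightFreyd V) := by
  have : HasBinaryBiproducts (Arrow V) := HasBinaryBiproducts.of_hasBinaryProducts
  have : HasBinaryBiproducts (RightFreyd V) := ⟨fun M N => by
    obtain ⟨m, rfl⟩ := freyd_obj_surjective M
    obtain ⟨n, rfl⟩ := freyd_obj_surjective N
    have := preservesBinaryBiproducts_of_preservesBiproducts (RightFreyd.quotient V)
    exact (RightFreyd.quotient V).hasBinaryBiproduct_of_preserves m n⟩
  have : HasZeroObject (RightFreyd V) :=
    ⟨freydProj _, (RightFreyd.functor V).map_isZero (isZero_zero V)⟩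
  exact hasFiniteProducts_of_has_binary_and_terminal

variable [HasWeakKernels V]

/-- In the Freyd category of a category with weak kernels every epimorphism is a cokernel. -/
@[reducible] def freydNormalEpi {M N : RightFreyd V} (φ : M ⟶ N) [Epi φ] : NormalEpi φ where
  W := kernel φ
  g := kernel.ι φ
  w := kernel.condition φ
  isColimit := CokernelCofork.IsColimit.ofπ' _ _ fun {T} ψ hψ => Classical.choice <| by
    obtain ⟨X, Y, r, p, hp, hrp, hdesc⟩ := exists_presentation N
    -- Since `ψ` kills everything that `φ` kills, `l ≫ ψ` does not depend on the chosen lift `l` of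
    -- `p` and respects the relations `r`, so it descends to `N`.
    let l := Projective.factorThru p φ
    have hl : l ≫ φ = p := Projective.factorThru_comp p φ
    have hker : ∀ {Z : V} (θ : freydProj Z ⟶ M), θ ≫ φ = 0 → θ ≫ ψ = 0 := fun θ hθ => by
      rw [← kernel.lift_ι φ θ hθ, Category.assoc, hψ, comp_zero]
    obtain ⟨χ, hχ⟩ := hdesc (l ≫ ψ) (by
      rw [← Category.assoc]
      exact hker _ (by rw [Category.assoc, hl, hrp]))
    refine ⟨χ, freyd_hom_ext fun Z θ => ?_⟩
    let μ := Projective.factorThru (θ ≫ φ) p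
    have hμ : μ ≫ p = θ ≫ φ := Projective.factorThru_comp _ _
    have h0 : (θ - μ ≫ l) ≫ ψ = 0 := hker _ (by simp [hl, hμ])
    rw [← reassoc_of% hμ, hχ]
    rw [Preadditive.sub_comp, sub_eq_zero, Category.assoc] at h0
    exact h0.symm

/-- In the Freyd category of a category with weak kernels every monomorphism is a kernel. -/
@[reducible] def freydNormalMono {M N : RightFreyd V} (φ : M ⟶ N) [Mono φ] : NormalMono φ where
  Z := cokernel φ
  g := cokernel.π φ
  w := cokernel.condition φ
  isLimit := KernelFork.IsLimit.ofι' _ _ fun {T} ψ hψ => Classical.choice <| by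
    obtain ⟨X, Y, r, p, hp, hrp, hdesc⟩ := exists_presentation T
    -- The composite `p ≫ ψ` dies in the cokernel of `φ`, so it lifts along `φ`; the lift kills `r`
    -- because `φ` is mono.
    obtain ⟨θ, hθ⟩ := exists_lift_of_forall_comp_eq_zero φ (p ≫ ψ) fun {S} χ hχ => by
      rw [← cokernel.π_desc φ χ hχ, Category.assoc, reassoc_of% hψ, zero_comp, comp_zero]
    obtain ⟨χ, hχ⟩ := hdesc θ (by
      rw [← cancel_mono φ, Category.assoc, hθ, reassoc_of% hrp, zero_comp, zero_comp])
    exact ⟨χ, by rw [← cancel_epi p, reassoc_of% hχ, hθ]⟩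

instance freydAbelian : Abelian (RightFreyd V) where
  normalMonoOfMono φ _ := ⟨freydNormalMono φ⟩
  normalEpiOfEpi φ _ := ⟨freydNormalEpi φ⟩

end Abelian

end Freyd

/-! ### Local projectives, composition series and multiplicities. -/

section AbelianCategory

variable {A : Type*} [Category* A] [Abelian A]

section LocalProjective

variable {P : A} [Projective P] (hP : ∀ e : End P, IsUnit e ∨ IsNilpotent e)

lemma eq_zero_of_isNilpotent {Q L : A} {e : End Q} (he : IsNilpotent e) {φ : Q ⟶ L}
    (h : (e : Q ⟶ Q) ≫ φ = φ) : φ = 0 := by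
  obtain ⟨n, hn⟩ := he
  have hpow : ∀ m : ℕ, ((e ^ m : End Q) : Q ⟶ Q) ≫ φ = φ := by
    intro m
    induction m with
    | zero => exact Category.id_comp φ
    | succ m ih =>
      rw [pow_succ]
      change (e ≫ (e ^ m : End Q)) ≫ φ = φ
      rw [Category.assoc, ih, h]
  rw [← hpow n, hn]
  exact zero_comp

include hP in
/-- A simple quotient of a projective object with local endomorphism ring is its largest
semisimple quotient. -/
lemma exists_comp_eq_of_local {L L' : A} [Simple L] [Simple L'] (p : P ⟶ L) [Epi p]
    (φ : P ⟶ L') : ∃ t : L ⟶ L', p ≫ t = φ := by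
  by_cases hk : kernel.ι p ≫ φ = 0
  · exact ⟨Abelian.epiDesc p φ hk, Abelian.comp_epiDesc p φ hk⟩
  exfalso
  -- Lifting `φ` through `kernel p` gives an endomorphism of `P` that fixes `φ` and is killed by
  -- `p`. If it is invertible, `p = 0`; if nilpotent, `φ = 0`.
  have hepi : Epi (kernel.ι p ≫ φ) := epi_of_nonzero_to_simple hk
  let s : P ⟶ kernel p := Projective.factorThru φ (kernel.ι p ≫ φ)
  have hs : s ≫ kernel.ι p ≫ φ = φ := Projective.factorThru_comp _ _
  rcases hP (s ≫ kernel.ι p) with hu | hn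
  · have hiso : IsIso (s ≫ kernel.ι p) := (isUnit_iff_isIso _).1 hu
    have h0 : p = 0 := by
      rw [← cancel_epi (s ≫ kernel.ι p)]
      simp
    exact Simple.not_isZero L (IsZero.of_epi_eq_zero p h0)
  · have h0 : φ = 0 := eq_zero_of_isNilpotent hn (by rw [Category.assoc, hs])
    exact hk (by rw [h0, comp_zero])

include hP in
lemma nonempty_iso_of_local {L L' : A} [Simple L] [Simple L'] (p : P ⟶ L) [Epi p]
    {φ : P ⟶ L'} (hφ : φ ≠ 0) : Nonempty (L ≅ L') := by
  obtain ⟨t, rfl⟩ := exists_comp_eq_of_local hP p φ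
  have ht : t ≠ 0 := by
    rintro rfl
    exact hφ comp_zero
  have := isIso_of_hom_simple ht
  exact ⟨asIso t⟩

include hP in
/-- A projective object with local endomorphism ring is a retract of every projective object
which maps onto its simple quotient. -/
lemma nonempty_retract_of_local {Q L : A} [Projective Q] [Simple L] (p : P ⟶ L) [Epi p]
    {φ : Q ⟶ L} (hφ : φ ≠ 0) : Nonempty (Retract P Q) := by
  have : Epi φ := epi_of_nonzero_to_simple hφ
  let s := Projective.factorThru p φ
  have hs : s ≫ φ = p := Projective.factorThru_comp _ _
  let t := Projective.factorThru φ p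
  have ht : t ≫ p = φ := Projective.factorThru_comp _ _
  rcases hP (s ≫ t) with hu | hn
  · have hiso : IsIso (s ≫ t) := (isUnit_iff_isIso _).1 hu
    exact ⟨⟨s, t ≫ inv (s ≫ t), by rw [← Category.assoc, IsIso.hom_inv_id]⟩⟩
  · have h0 : p = 0 := eq_zero_of_isNilpotent hn (by rw [Category.assoc, ht, hs])
    exact absurd (IsZero.of_epi_eq_zero p h0) (Simple.not_isZero L)

end LocalProjective

section Length

variable (𝕜 : Type*) [Field 𝕜] [Linear 𝕜 A]

lemma finrank_hom_eq_add {P : A} [Projective P] [∀ M : A, FiniteDimensional 𝕜 (P ⟶ M)]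
    {S : ShortComplex A} (hS : S.ShortExact) :
    Module.finrank 𝕜 (P ⟶ S.X₂) =
      Module.finrank 𝕜 (P ⟶ S.X₁) + Module.finrank 𝕜 (P ⟶ S.X₃) := by
  have := hS.mono_f
  have := hS.epi_g
  have hinj : Function.Injective (Linear.rightComp 𝕜 P S.f) := fun φ ψ h =>
    (cancel_mono S.f).1 h
  have hker : LinearMap.ker (Linear.rightComp 𝕜 P S.g) =
      LinearMap.range (Linear.rightComp 𝕜 P S.f) := by
    ext φ
    constructor
    · intro h
      exact ⟨hS.exact.lift φ h, hS.exact.lift_f φ h⟩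
    · rintro ⟨ψ, rfl⟩
      simp
  have hrange : LinearMap.range (Linear.rightComp 𝕜 P S.g) = ⊤ :=
    LinearMap.range_eq_top.2 fun φ =>
      ⟨Projective.factorThru φ S.g, Projective.factorThru_comp φ S.g⟩
  have h := LinearMap.finrank_range_add_finrank_ker (Linear.rightComp 𝕜 P S.g)
  rw [hker, hrange, finrank_top, LinearMap.finrank_range_of_inj hinj] at h
  omega

lemma shortExact_kernel {M N : A} (q : M ⟶ N) [Epi q] :
    (ShortComplex.mk (kernel.ι q) q (kernel.condition q)).ShortExact where
  exact := ShortComplex.exact_of_f_is_kernel _ (kernelIsKernel q)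
  mono_f := inferInstanceAs (Mono (kernel.ι q))
  epi_g := inferInstanceAs (Epi q)

variable {G : A} [Projective G] [∀ M : A, FiniteDimensional 𝕜 (G ⟶ M)]
  (hG : ∀ M : A, (∀ φ : G ⟶ M, φ = 0) → IsZero M)

omit [Projective G] in
include hG in
lemma finrank_hom_pos {M : A} (hM : ¬ IsZero M) : 0 < Module.finrank 𝕜 (G ⟶ M) := by
  have : Nontrivial (G ⟶ M) := by
    by_contra h
    rw [not_nontrivial_iff_subsingleton] at h
    exact hM (hG M fun φ => Subsingleton.elim _ _)
  exact Module.finrank_pos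

include 𝕜 hG in
-- A nonsimple `M` has a nonzero epimorphism `f` that is not invertible. Its kernel is nonzero, so
-- its target has a strictly smaller space of morphisms from `G`.
lemma exists_simple_quotient (M : A) (hM : ¬ IsZero M) :
    ∃ (L : A) (q : M ⟶ L), Simple L ∧ Epi q := by
  induction hn : Module.finrank 𝕜 (G ⟶ M) using Nat.strong_induction_on generalizing M with
  | _ n ih =>
    subst hn
    by_cases hs : Simple M
    · exact ⟨M, 𝟙 M, hs, inferInstance⟩
    obtain ⟨Z, f, hf, hiff⟩ : ∃ (Z : A) (f : M ⟶ Z), Epi f ∧ ¬ (IsIso f ↔ f ≠ 0) := by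
      by_contra! h
      exact hs (simple_of_cosimple M fun f _ => h _ f inferInstance)
    have h1 : IsIso f → f ≠ 0 := by
      rintro _ rfl
      exact hM (IsZero.of_mono_eq_zero (0 : M ⟶ Z) rfl)
    have h2 : f ≠ 0 := by
      by_contra h
      exact hiff ⟨h1, fun h' => absurd h h'⟩
    have h3 : ¬ IsIso f := fun h => hiff ⟨h1, fun _ => h⟩
    have hZ : ¬ IsZero Z := fun h => h2 (h.eq_of_tgt _ _)
    have hK : ¬ IsZero (kernel f) := fun h => h3 <| by
      have : Mono f := Preadditive.mono_of_kernel_zero (h.eq_of_src _ _)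
      exact isIso_of_mono_of_epi f
    have hadd := finrank_hom_eq_add 𝕜 (P := G) (shortExact_kernel f)
    have hpos := finrank_hom_pos 𝕜 hG hK
    dsimp only at hadd
    obtain ⟨L, q, hL, hq⟩ := ih _ (by omega) Z hZ rfl
    exact ⟨L, f ≫ q, hL, inferInstance⟩

include 𝕜 hG in
lemma exists_isCompositionSeries (M : A) : ∃ l, IsCompositionSeries M l := by
  induction hn : Module.finrank 𝕜 (G ⟶ M) using Nat.strong_induction_on generalizing M with
  | _ n ih =>
    subst hn
    by_cases hM : IsZero M
    · exact ⟨[], .zero M hM⟩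
    obtain ⟨L, q, hL, hq⟩ := exists_simple_quotient 𝕜 hG M hM
    have hadd := finrank_hom_eq_add 𝕜 (P := G) (shortExact_kernel q)
    have hpos := finrank_hom_pos 𝕜 hG hL.not_isZero
    dsimp only at hadd
    obtain ⟨l, hl⟩ := ih _ (by omega) (kernel q) rfl
    exact ⟨L :: l, .cons _ (shortExact_kernel q) hL l hl⟩

variable {P : A} [Projective P] [∀ M : A, FiniteDimensional 𝕜 (P ⟶ M)]

open Classical in
-- Each factor isomorphic to `L` contributes at least one dimension, by additivity.
lemma IsCompositionSeries.countP_le_finrank {L : A} [Simple L] (p : P ⟶ L) [Epi p] {M : A}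
    {l : List A} (hl : IsCompositionSeries M l) :
    l.countP (fun X => decide (Nonempty (X ≅ L))) ≤ Module.finrank 𝕜 (P ⟶ M) := by
  induction hl with
  | zero M hM => simp
  | cons S hS hX l hl ih =>
    rw [finrank_hom_eq_add 𝕜 hS, List.countP_cons]
    split_ifs with h
    · obtain ⟨φ⟩ := of_decide_eq_true h
      have : Nontrivial (P ⟶ S.X₃) := by
        refine ⟨p ≫ φ.inv, 0, fun h0 => ?_⟩
        have h1 : p = 0 := by simpa using h0 =≫ φ.hom
        exact Simple.not_isZero L (IsZero.of_epi_eq_zero p h1)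
      have := Module.finrank_pos (R := 𝕜) (M := P ⟶ S.X₃)
      omega
    · omega

open Classical in
-- Either `φ` survives on the top factor, which is then isomorphic to `L` by locality of `P`, or it
-- lifts to the next term of the series.
lemma IsCompositionSeries.countP_pos (hP : ∀ e : End P, IsUnit e ∨ IsNilpotent e)
    {L : A} [Simple L] (p : P ⟶ L) [Epi p] {M : A}
    {l : List A} (hl : IsCompositionSeries M l) {φ : P ⟶ M} (hφ : φ ≠ 0) :
    0 < l.countP (fun X => decide (Nonempty (X ≅ L))) := by
  induction hl with
  | zero M hM => exact absurd (hM.eq_of_tgt _ _) hφ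
  | cons S hS hX l hl ih =>
    rw [List.countP_cons]
    by_cases h : φ ≫ S.g = 0
    · have := hS.mono_f
      have hlift : hS.exact.lift φ h ≠ 0 := fun h0 => hφ <| by
        rw [← hS.exact.lift_f φ h, h0, zero_comp]
      have := ih hlift
      omega
    · obtain ⟨ψ⟩ := nonempty_iso_of_local hP p h
      have hne : Nonempty (S.X₃ ≅ L) := ⟨ψ.symm⟩
      simp [hne]

open Classical in
include 𝕜 hG in
/-- The multiplicity of the simple quotient of a local projective object `P` in `M` is nonzero if
and only if there is a nonzero morphism from `P` to `M`. -/
theorem multiplicity_ne_zero_iff (hP : ∀ e : End P, IsUnit e ∨ IsNilpotent e)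
    {L : A} [Simple L] (p : P ⟶ L) [Epi p] (M : A) :
    multiplicity M L ≠ 0 ↔ ∃ φ : P ⟶ M, φ ≠ 0 := by
  constructor
  · intro h
    by_contra! h0
    have hsub : Subsingleton (P ⟶ M) := ⟨fun φ ψ => (h0 φ).trans (h0 ψ).symm⟩
    refine h (Nat.eq_zero_of_le_zero ?_)
    obtain ⟨l, hl⟩ := exists_isCompositionSeries 𝕜 hG M
    refine csSup_le ⟨_, l, hl, rfl⟩ ?_
    rintro n ⟨l, hl, rfl⟩
    exact (hl.countP_le_finrank 𝕜 p).trans (Module.finrank_zero_of_subsingleton).le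
  · rintro ⟨φ, hφ⟩
    obtain ⟨l, hl⟩ := exists_isCompositionSeries 𝕜 hG M
    -- Boundedness matters: `sSup` of an unbounded set of natural numbers is `0`.
    have hbdd : BddAbove {n | ∃ l : List A, IsCompositionSeries M l ∧
        n = l.countP (fun X => decide (Nonempty (X ≅ L)))} := by
      refine ⟨Module.finrank 𝕜 (P ⟶ M), ?_⟩
      rintro n ⟨l, hl, rfl⟩
      exact hl.countP_le_finrank 𝕜 p
    exact ((hl.countP_pos hP p hφ).trans_le (le_csSup hbdd ⟨l, hl, rfl⟩)).ne'

end Length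

end AbelianCategory

/-! ### Simple objects of the Freyd category. -/

section FreydSimples

open Preadditive

variable {V : Type*} [Category* V] [Preadditive V] [HasZeroObject V]
  (𝕜 : Type*) [Field 𝕜] [Linear 𝕜 V]

instance : (RightFreyd.quotient V).Linear 𝕜 where
  map_smul _ _ := rfl

lemma freydElement_smul (a : Arrow V) {X : V} (c : 𝕜) (b : X ⟶ a.right) :
    freydElement a (c • b) = c • freydElement a b := by
  rw [freydElement, freydElement, ← Functor.map_smul]
  refine (RightFreyd.quotient V).congr_map ?_
  ext
  · exact (isZero_zero V).eq_of_src _ _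
  · rfl

variable [∀ X Y : V, FiniteDimensional 𝕜 (X ⟶ Y)]

lemma finiteDimensional_freydProj_hom (X : V) (M : RightFreyd V) :
    FiniteDimensional 𝕜 (freydProj X ⟶ M) := by
  obtain ⟨a, rfl⟩ := freyd_obj_surjective M
  let f : (X ⟶ a.right) →ₗ[𝕜] (freydProj X ⟶ (RightFreyd.quotient V).obj a) :=
    { toFun := freydElement a
      map_add' := freydElement_add a
      map_smul' := freydElement_smul 𝕜 a }
  exact Module.Finite.of_surjective f (freydElement_surjective a)

lemma finiteDimensional_freyd_hom (M N : RightFreyd V) : FiniteDimensional 𝕜 (M ⟶ N) := by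
  obtain ⟨X, Y, r, p, hp, -⟩ := exists_presentation M
  have := finiteDimensional_freydProj_hom 𝕜 Y N
  exact Module.Finite.of_injective (Linear.leftComp 𝕜 N p) fun φ ψ h => (cancel_epi p).1 h

variable [HasBinaryBiproducts V]

include 𝕜 in
-- The embedding of `V` is full, so locality is inherited from `End X`.
lemma isUnit_or_isNilpotent_end_freydProj [IsIdempotentComplete V] {X : V}
    (hX : Indecomposable X) (e : End (freydProj X)) : IsUnit e ∨ IsNilpotent e := by
  obtain ⟨x, rfl⟩ := (RightFreyd.functor V).map_surjective e
  rcases isUnit_or_isNilpotent_of_indecomposable 𝕜 hX x with h | ⟨n, hn⟩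
  · exact Or.inl (h.map ((RightFreyd.functor V).mapEnd X))
  · refine Or.inr ⟨n, ?_⟩
    have h := map_pow (G := End X) ((RightFreyd.functor V).mapEnd X) x n
    rw [hn] at h
    exact h.symm.trans ((RightFreyd.functor V).map_zero X X)

include 𝕜 in
lemma IsAdditiveGenerator.isZero {G : V} (hG : IsAdditiveGenerator G) (M : RightFreyd V)
    (hM : ∀ φ : freydProj G ⟶ M, φ = 0) : IsZero M := by
  have key : ∀ (X : V) (φ : freydProj X ⟶ M), φ = 0 := by
    intro X
    refine indecomposable_induction 𝕜 (Q := fun X => ∀ φ : freydProj X ⟶ M, φ = 0) ?_ ?_ ?_ X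
    · intro X hX φ
      exact ((RightFreyd.functor V).map_isZero hX).eq_of_src _ _
    · intro X hX φ
      obtain ⟨r⟩ := hG X hX
      have h := hM ((RightFreyd.functor V).map r.r ≫ φ)
      have h' := (RightFreyd.functor V).map r.i ≫= h
      rw [← Category.assoc, ← Functor.map_comp, r.retract] at h'
      rw [(RightFreyd.functor V).map_id, comp_zero] at h'
      exact (Category.id_comp φ).symm.trans h'
    · intro X Y Z ψ hY hZ φ
      have hid : 𝟙 X = (ψ.hom ≫ biprod.fst) ≫ biprod.inl ≫ ψ.inv +
          (ψ.hom ≫ biprod.snd) ≫ biprod.inr ≫ ψ.inv := by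
        rw [← cancel_mono ψ.hom]
        ext <;> simp
      rw [← Category.id_comp φ, ← (RightFreyd.functor V).map_id, hid, Functor.map_add,
        Functor.map_comp, Functor.map_comp _ (ψ.hom ≫ biprod.snd), Preadditive.add_comp,
        Category.assoc, Category.assoc, hY ((RightFreyd.functor V).map (biprod.inl ≫ ψ.inv) ≫ φ),
        hZ ((RightFreyd.functor V).map (biprod.inr ≫ ψ.inv) ≫ φ), comp_zero, comp_zero, add_zero]
  rw [IsZero.iff_id_eq_zero]
  exact freyd_hom_ext fun X θ => (key X (θ ≫ 𝟙 M)).trans (key X (θ ≫ 0)).symm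

variable [IsIdempotentComplete V] {G : V} (hG : IsAdditiveGenerator G)

omit [IsIdempotentComplete V] in
include 𝕜 hG in
lemma exists_simple_quotient_freydProj {X : V} (hX : ¬ IsZero X) :
    ∃ L : RightFreyd V, Simple L ∧ ∃ p : freydProj X ⟶ L, Epi p := by
  have := hG.hasWeakKernels 𝕜
  have := finiteDimensional_freydProj_hom 𝕜 G
  obtain ⟨L, q, hL, hq⟩ := exists_simple_quotient 𝕜 (hG.isZero 𝕜) (freydProj X) fun h => hX <| by
    rw [IsZero.iff_id_eq_zero] at h ⊢
    exact (RightFreyd.functor V).map_injective (by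
      rw [(RightFreyd.functor V).map_id, (RightFreyd.functor V).map_zero, h])
  exact ⟨L, hL, q, hq⟩

include 𝕜 hG

/-- For an indecomposable object `X`, the simple quotient of `freydProj X` is a quotient of
`freydProj Y` if and only if `X` is a direct summand of `Y`. -/
lemma exists_freydProj_hom_ne_zero_iff {X Y : V} (hX : Indecomposable X) {L : RightFreyd V}
    (hL : Simple L ∧ ∃ p : freydProj X ⟶ L, Epi p) :
    (∃ φ : freydProj Y ⟶ L, φ ≠ 0) ↔ ∃ Z : V, Nonempty (Y ≅ X ⊞ Z) := by
  have := hG.hasWeakKernels 𝕜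
  obtain ⟨hL, p, hp⟩ := hL
  constructor
  · rintro ⟨φ, hφ⟩
    have hP := isUnit_or_isNilpotent_end_freydProj 𝕜 hX
    obtain ⟨r⟩ := nonempty_retract_of_local (P := freydProj X) (Q := freydProj Y) hP p hφ
    obtain ⟨i, hi⟩ := (RightFreyd.functor V).map_surjective r.i
    obtain ⟨e, he⟩ := (RightFreyd.functor V).map_surjective r.r
    have hie : i ≫ e = 𝟙 X := (RightFreyd.functor V).map_injective (by
      rw [Functor.map_comp, hi, he, r.retract, (RightFreyd.functor V).map_id])
    obtain ⟨Z, -, -, ψ, -⟩ := nonempty_iso_biprod_of_idempotent hie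
    exact ⟨Z, ⟨ψ⟩⟩
  · rintro ⟨Z, ⟨ψ⟩⟩
    refine ⟨(RightFreyd.functor V).map (ψ.hom ≫ biprod.fst) ≫ p, fun h => ?_⟩
    have h' := (RightFreyd.functor V).map (biprod.inl ≫ ψ.inv) ≫= h
    rw [← Category.assoc, ← Functor.map_comp] at h'
    have hid : (biprod.inl ≫ ψ.inv) ≫ ψ.hom ≫ biprod.fst = 𝟙 X := by simp
    rw [hid, (RightFreyd.functor V).map_id, comp_zero] at h'
    have hp0 : p = 0 := (Category.id_comp p).symm.trans h'
    exact Simple.not_isZero L (IsZero.of_epi_eq_zero p hp0)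

lemma multiplicity_ne_zero_iff_freydProj {X : V} (hX : Indecomposable X) {L : RightFreyd V}
    (hL : Simple L ∧ ∃ p : freydProj X ⟶ L, Epi p) (M : RightFreyd V) :
    multiplicity M L ≠ 0 ↔ ∃ φ : freydProj X ⟶ M, φ ≠ 0 := by
  have := hG.hasWeakKernels 𝕜
  have := finiteDimensional_freydProj_hom (V := V) 𝕜
  obtain ⟨hL, p, hp⟩ := hL
  exact multiplicity_ne_zero_iff 𝕜 (hG.isZero 𝕜) (isUnit_or_isNilpotent_end_freydProj 𝕜 hX) p M

end FreydSimples

/-! ### Functors and adjunctions on Freyd categories. -/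

section FreydFunctors

open Preadditive

variable {V W : Type*} [Category* V] [Category* W] [Preadditive V] [Preadditive W]

instance freydMap_additive (F : V ⥤ W) [F.Additive] : (freydMap F).Additive where
  map_add {M N φ ψ} := by
    obtain ⟨φ, rfl⟩ := (RightFreyd.quotient V).map_surjective (X := M.as) (Y := N.as) φ
    obtain ⟨ψ, rfl⟩ := (RightFreyd.quotient V).map_surjective (X := M.as) (Y := N.as) ψ
    change (RightFreyd.quotient W).map (F.mapArrow.map (φ + ψ)) =
      (RightFreyd.quotient W).map (F.mapArrow.map φ + F.mapArrow.map ψ)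
    refine (RightFreyd.quotient W).congr_map ?_
    ext
    · exact F.map_add
    · exact F.map_add

instance freydMap_linear (𝕜 : Type*) [Semiring 𝕜] [Linear 𝕜 V] [Linear 𝕜 W] (F : V ⥤ W)
    [F.Additive] [F.Linear 𝕜] : (freydMap F).Linear 𝕜 where
  map_smul {M N} φ c := by
    obtain ⟨φ, rfl⟩ := (RightFreyd.quotient V).map_surjective (X := M.as) (Y := N.as) φ
    change (RightFreyd.quotient W).map (F.mapArrow.map (c • φ)) =
      (RightFreyd.quotient W).map (c • F.mapArrow.map φ)
    refine (RightFreyd.quotient W).congr_map ?_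
    ext
    · exact F.map_smul c _
    · exact F.map_smul c _

/-- The action of a natural transformation on abelianizations. -/
def freydNatApp {F F' : V ⥤ W} [F.Additive] [F'.Additive] (α : F ⟶ F') (M : RightFreyd V) :
    (freydMap F).obj M ⟶ (freydMap F').obj M :=
  (RightFreyd.quotient W).map (X := F.mapArrow.obj M.as) (Y := F'.mapArrow.obj M.as)
    (Arrow.homMk (α.app _) (α.app _) (α.naturality _).symm)

lemma freydNatApp_add {F F' : V ⥤ W} [F.Additive] [F'.Additive] (α β : F ⟶ F')
    (M : RightFreyd V) : freydNatApp (α + β) M = freydNatApp α M + freydNatApp β M :=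
  rfl

lemma freydNatApp_comp {F F' F'' : V ⥤ W} [F.Additive] [F'.Additive] [F''.Additive] (α : F ⟶ F')
    (β : F' ⟶ F'') (M : RightFreyd V) :
    freydNatApp (α ≫ β) M = freydNatApp α M ≫ freydNatApp β M :=
  (RightFreyd.quotient W).map_comp (X := F.mapArrow.obj M.as) (Y := F'.mapArrow.obj M.as)
    (Z := F''.mapArrow.obj M.as) (Arrow.homMk (α.app _) (α.app _) (α.naturality _).symm)
    (Arrow.homMk (β.app _) (β.app _) (β.naturality _).symm)

lemma freydNatApp_id (F : V ⥤ W) [F.Additive] (M : RightFreyd V) :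
    freydNatApp (𝟙 F) M = 𝟙 _ :=
  (RightFreyd.quotient W).map_id _

/-- Adjoint functors induce adjoint functors on abelianizations. -/
def freydAdjunction {F : V ⥤ W} {G : W ⥤ V} [F.Additive] [G.Additive]
    (adj : CategoryTheory.Adjunction F G) :
    CategoryTheory.Adjunction (freydMap F) (freydMap G) where
  unit :=
    { app := fun M => (RightFreyd.quotient V).map (X := M.as)
        (Y := G.mapArrow.obj (F.mapArrow.obj M.as))
        (Arrow.homMk (adj.unit.app _) (adj.unit.app _) (adj.unit.naturality _).symm)
      naturality := fun M N φ => by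
        obtain ⟨φ, rfl⟩ := (RightFreyd.quotient V).map_surjective (X := M.as) (Y := N.as) φ
        change (RightFreyd.quotient V).map φ ≫ (RightFreyd.quotient V).map _ =
          (RightFreyd.quotient V).map _ ≫
            (RightFreyd.quotient V).map (G.mapArrow.map (F.mapArrow.map φ))
        rw [← Functor.map_comp, ← Functor.map_comp]
        refine (RightFreyd.quotient V).congr_map ?_
        ext
        · exact adj.unit.naturality φ.left
        · exact adj.unit.naturality φ.right }
  counit :=
    { app := fun M => (RightFreyd.quotient W).map (X := F.mapArrow.obj (G.mapArrow.obj M.as))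
        (Y := M.as)
        (Arrow.homMk (adj.counit.app _) (adj.counit.app _) (adj.counit.naturality _).symm)
      naturality := fun M N φ => by
        obtain ⟨φ, rfl⟩ := (RightFreyd.quotient W).map_surjective (X := M.as) (Y := N.as) φ
        change (RightFreyd.quotient W).map (F.mapArrow.map (G.mapArrow.map φ)) ≫
            (RightFreyd.quotient W).map _ =
          (RightFreyd.quotient W).map _ ≫ (RightFreyd.quotient W).map φ
        rw [← Functor.map_comp, ← Functor.map_comp]
        refine (RightFreyd.quotient W).congr_map ?_
        ext
        · exact adj.counit.naturality φ.left
        · exact adj.counit.naturality φ.right }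
  left_triangle_components M := by
    obtain ⟨m, rfl⟩ := freyd_obj_surjective M
    let η : m ⟶ G.mapArrow.obj (F.mapArrow.obj m) :=
      Arrow.homMk (adj.unit.app _) (adj.unit.app _) (adj.unit.naturality _).symm
    let ζ : F.mapArrow.obj (G.mapArrow.obj (F.mapArrow.obj m)) ⟶ F.mapArrow.obj m :=
      Arrow.homMk (adj.counit.app _) (adj.counit.app _) (adj.counit.naturality _).symm
    refine ((RightFreyd.quotient W).map_comp (F.mapArrow.map η) ζ).symm.trans
      (((RightFreyd.quotient W).congr_map ?_).trans ((RightFreyd.quotient W).map_id _))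
    ext
    · exact adj.left_triangle_components _
    · exact adj.left_triangle_components _
  right_triangle_components M := by
    obtain ⟨m, rfl⟩ := freyd_obj_surjective M
    let η : G.mapArrow.obj m ⟶ G.mapArrow.obj (F.mapArrow.obj (G.mapArrow.obj m)) :=
      Arrow.homMk (adj.unit.app _) (adj.unit.app _) (adj.unit.naturality _).symm
    let ζ : F.mapArrow.obj (G.mapArrow.obj m) ⟶ m :=
      Arrow.homMk (adj.counit.app _) (adj.counit.app _) (adj.counit.naturality _).symm
    refine ((RightFreyd.quotient V).map_comp η (G.mapArrow.map ζ)).symm.trans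
      (((RightFreyd.quotient V).congr_map ?_).trans ((RightFreyd.quotient V).map_id _))
    ext
    · exact adj.right_triangle_components _
    · exact adj.right_triangle_components _

variable [HasZeroObject V] [HasZeroObject W]

/-- The functors between abelianizations are compatible with the projective objects. -/
def freydMapObjProj (F : V ⥤ W) [F.Additive] (X : V) :
    (freydMap F).obj (freydProj X) ≅ freydProj (F.obj X) :=
  (RightFreyd.quotient W).mapIso
    (X := F.mapArrow.obj ((RightFreyd.rightFunctor V).obj X))
    (Y := (RightFreyd.rightFunctor W).obj (F.obj X))
    (Arrow.isoMk ((F.map_isZero (isZero_zero V)).iso (isZero_zero W)) (Iso.refl _)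
      ((F.map_isZero (isZero_zero V)).eq_of_src _ _))

end FreydFunctors

/-! ### The action on principal 2-representations. -/

section PrincipalAction

variable {B : Type u} [Bicategory.{w, v} B]

/-- An adjunction between 1-morphisms induces an adjunction between the functors given by
postcomposition. -/
def postcompAdjunction (i : B) {j k : B} {f : j ⟶ k} {g : k ⟶ j} (adj : f ⊣ g) :
    CategoryTheory.Adjunction (postcomp i f) (postcomp i g) where
  unit :=
    { app := fun x => (ρ_ x).inv ≫ x ◁ adj.unit ≫ (α_ x f g).inv
      naturality := fun x y a => by
        change a ≫ (ρ_ y).inv ≫ y ◁ adj.unit ≫ (α_ y f g).inv =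
          ((ρ_ x).inv ≫ x ◁ adj.unit ≫ (α_ x f g).inv) ≫ a ▷ f ▷ g
        rw [Category.assoc, Category.assoc, ← associator_inv_naturality_left,
          whisker_exchange_assoc, rightUnitor_inv_naturality_assoc] }
  counit :=
    { app := fun x => (α_ x g f).hom ≫ x ◁ adj.counit ≫ (ρ_ x).hom
      naturality := fun x y a => by
        change a ▷ g ▷ f ≫ (α_ y g f).hom ≫ y ◁ adj.counit ≫ (ρ_ y).hom =
          ((α_ x g f).hom ≫ x ◁ adj.counit ≫ (ρ_ x).hom) ≫ a
        rw [Category.assoc, Category.assoc, ← rightUnitor_naturality, whisker_exchange_assoc,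
          associator_naturality_left_assoc] }
  left_triangle_components x := by
    change ((ρ_ x).inv ≫ x ◁ adj.unit ≫ (α_ x f g).inv) ▷ f ≫
      (α_ (x ≫ f) g f).hom ≫ (x ≫ f) ◁ adj.counit ≫ (ρ_ (x ≫ f)).hom = 𝟙 (x ≫ f)
    calc
      _ = 𝟙 _ ⊗≫ x ◁ leftZigzag adj.unit adj.counit ⊗≫ 𝟙 _ := by
        dsimp only [leftZigzag]; bicategory
      _ = 𝟙 (x ≫ f) := by rw [adj.left_triangle]; bicategory
  right_triangle_components x := by
    change ((ρ_ (x ≫ g)).inv ≫ (x ≫ g) ◁ adj.unit ≫ (α_ (x ≫ g) f g).inv) ≫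
      ((α_ x g f).hom ≫ x ◁ adj.counit ≫ (ρ_ x).hom) ▷ g = 𝟙 (x ≫ g)
    calc
      _ = 𝟙 _ ⊗≫ x ◁ rightZigzag adj.unit adj.counit ⊗≫ 𝟙 _ := by
        dsimp only [rightZigzag]; bicategory
      _ = 𝟙 (x ≫ g) := by rw [adj.right_triangle]; bicategory

variable [AdditiveTwoCategory B]

instance postcomp_linear (𝕜 : Type*) [Field 𝕜] [LinearTwoCategory 𝕜 B] (i : B) {j k : B}
    (f : j ⟶ k) : (postcomp i f).Linear 𝕜 where
  map_smul α c := LinearTwoCategory.smul_whiskerRight c α f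

/-- The natural transformation between postcomposition functors given by a 2-morphism. -/
abbrev postcompMap (i : B) {j k : B} {f f' : j ⟶ k} (α : f ⟶ f') : postcomp i f ⟶ postcomp i f' :=
  (postcomposing i j k).map α

/-- The morphism between the actions of two 1-morphisms on an object given by a 2-morphism. -/
def actHom {i j k : B} {f f' : j ⟶ k} (α : f ⟶ f') (M : Principal i j) :
    (act f).obj M ⟶ (act f').obj M :=
  freydNatApp (postcompMap i α) M

lemma actHom_add {i j k : B} {f f' : j ⟶ k} (α β : f ⟶ f') (M : Principal i j) :
    actHom (α + β) M = actHom α M + actHom β M := by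
  have h : postcompMap i (α + β) = postcompMap i α + postcompMap i β := by
    ext x
    exact AdditiveTwoCategory.whiskerLeft_add x α β
  rw [actHom, h]
  exact freydNatApp_add _ _ _

lemma actHom_comp {i j k : B} {f f' f'' : j ⟶ k} (α : f ⟶ f') (β : f' ⟶ f'')
    (M : Principal i j) : actHom (α ≫ β) M = actHom α M ≫ actHom β M := by
  have h : postcompMap i (α ≫ β) = postcompMap i α ≫ postcompMap i β :=
    (postcomposing i j k).map_comp α β
  rw [actHom, h]
  exact freydNatApp_comp _ _ _

lemma actHom_id {i j k : B} (f : j ⟶ k) (M : Principal i j) : actHom (𝟙 f) M = 𝟙 _ := by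
  have h : postcompMap i (𝟙 f) = 𝟙 _ := (postcomposing i j k).map_id f
  rw [actHom, h]
  exact freydNatApp_id _ _

lemma isZero_act_obj {i j k : B} {f : j ⟶ k} (hf : IsZero f) (M : Principal i j) :
    IsZero ((act f).obj M) := by
  rw [IsZero.iff_id_eq_zero, ← actHom_id]
  have h : 𝟙 f + 𝟙 f = 𝟙 f := hf.eq_of_src _ _
  have h' := actHom_add (𝟙 f) (𝟙 f) M
  rw [h] at h'
  exact left_eq_add.1 h'

/-- The action of `f` sends `P_x` to `P_{f ∘ x}`. -/
def actProj {i j k : B} (f : j ⟶ k) (x : i ⟶ j) : (act f).obj (proj x) ≅ proj (x ≫ f) :=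
  freydMapObjProj (postcomp i f) x

lemma exists_proj_hom_ne_zero_iff {i j k : B} {f : j ⟶ k} {g : k ⟶ j}
    (adj : CategoryTheory.Adjunction (act (i := i) f) (act g)) (x : i ⟶ j) (M : Principal i k) :
    (∃ φ : proj x ⟶ (act g).obj M, φ ≠ 0) ↔ ∃ φ : proj (x ≫ f) ⟶ M, φ ≠ 0 := by
  let e := adj.homEquiv (proj x) M
  -- Only nonvanishing is transported, so it suffices that the bijection fixes `0`.
  have he : ∀ φ, e φ = 0 ↔ φ = 0 := fun φ => by
    have h0 : e 0 = 0 := by rw [adj.homEquiv_unit, Functor.map_zero, comp_zero]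
    rw [← h0, e.apply_eq_iff_eq]
  constructor
  · rintro ⟨φ, hφ⟩
    obtain ⟨ψ, rfl⟩ := e.surjective φ
    refine ⟨(actProj f x).inv ≫ ψ, fun h => hφ ((he ψ).2 ?_)⟩
    rw [← cancel_epi (actProj f x).inv, h, comp_zero]
  · rintro ⟨φ, hφ⟩
    refine ⟨e ((actProj f x).hom ≫ φ), fun h => hφ ?_⟩
    rw [← cancel_epi (actProj f x).hom, (he _).1 h, comp_zero]

end PrincipalAction

/-! ### The key equivalence and its consequences for cells. -/

section FiatCategory

variable (𝕜 : Type*) [Field 𝕜] {B : Type u} [Bicategory.{w, v} B]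
  [AdditiveTwoCategory B] [LinearTwoCategory 𝕜 B] [WeakInvolution B] [FiatCategory 𝕜 B]

include 𝕜

lemma nonempty_act_adjunction (i : B) {j k : B} (f : j ⟶ k) :
    Nonempty (CategoryTheory.Adjunction (act (i := i) f) (act (dual f))) :=
  (FiatCategory.adjunction 𝕜 f).map fun adj => freydAdjunction (postcompAdjunction i adj)

/-- The right adjoint of `f*` is `f**`, which is replaced by `f` along `starStar`. -/
lemma nonempty_act_dual_adjunction (i : B) {j k : B} (f : j ⟶ k) :
    Nonempty (CategoryTheory.Adjunction (act (i := i) (dual f)) (act f)) :=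
  (FiatCategory.adjunction 𝕜 (dual f)).map fun adj =>
    freydAdjunction ((postcompAdjunction i adj).ofNatIsoRight
      ((postcomposing i j k).mapIso (WeakInvolution.starStar f)))

lemma exists_additiveGenerator (i j : B) : ∃ G : i ⟶ j, IsAdditiveGenerator G :=
  exists_isAdditiveGenerator (FiatCategory.finite_indecomposables 𝕜 i j)

lemma hasWeakKernels (i j : B) : HasWeakKernels (i ⟶ j) := by
  have := FiatCategory.finiteDimensional (𝕜 := 𝕜) (B := B) (i := i) (j := j)
  obtain ⟨G, hG⟩ := exists_additiveGenerator 𝕜 i j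
  exact hG.hasWeakKernels 𝕜

lemma exists_proj_hom_simple_ne_zero_iff {i j : B} {g x : i ⟶ j} (hg : Indecomposable g)
    {L : Principal i j} (hL : IsSimpleQuotient g L) :
    (∃ φ : proj x ⟶ L, φ ≠ 0) ↔ IsSummand g x := by
  have := FiatCategory.finiteDimensional (𝕜 := 𝕜) (B := B) (i := i) (j := j)
  have := FiatCategory.isIdempotentComplete 𝕜 i j
  obtain ⟨G, hG⟩ := exists_additiveGenerator 𝕜 i j
  exact exists_freydProj_hom_ne_zero_iff 𝕜 hG hg hL

lemma multiplicity_simple_ne_zero_iff {i j : B} {g : i ⟶ j} (hg : Indecomposable g)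
    {L : Principal i j} (hL : IsSimpleQuotient g L) (M : Principal i j) :
    multiplicity M L ≠ 0 ↔ ∃ φ : proj g ⟶ M, φ ≠ 0 := by
  have := FiatCategory.finiteDimensional (𝕜 := 𝕜) (B := B) (i := i) (j := j)
  have := FiatCategory.isIdempotentComplete 𝕜 i j
  obtain ⟨G, hG⟩ := exists_additiveGenerator 𝕜 i j
  exact multiplicity_ne_zero_iff_freydProj 𝕜 hG hg hL M

/-- A 1-morphism `f` maps `L_g` to an object with a nonzero morphism from `P_x` if and only if `g`
is a direct summand of `f* ∘ x`. -/
lemma exists_proj_hom_act_ne_zero_iff {i j k : B} {g : i ⟶ j} (hg : Indecomposable g)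
    {L : Principal i j} (hL : IsSimpleQuotient g L) (f : j ⟶ k) (x : i ⟶ k) :
    (∃ φ : proj x ⟶ (act f).obj L, φ ≠ 0) ↔ IsSummand g (x ≫ dual f) := by
  obtain ⟨adj⟩ := nonempty_act_dual_adjunction 𝕜 i f
  rw [exists_proj_hom_ne_zero_iff adj, exists_proj_hom_simple_ne_zero_iff 𝕜 hg hL]

/-- The adjoint form of `exists_proj_hom_act_ne_zero_iff`. -/
lemma exists_proj_hom_act_dual_ne_zero_iff {i j k : B} {g : i ⟶ j} (hg : Indecomposable g)
    {L : Principal i j} (hL : IsSimpleQuotient g L) (f : k ⟶ j) (x : i ⟶ k) :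
    (∃ φ : proj x ⟶ (act (dual f)).obj L, φ ≠ 0) ↔ IsSummand g (x ≫ f) := by
  obtain ⟨adj⟩ := nonempty_act_adjunction 𝕜 i f
  rw [exists_proj_hom_ne_zero_iff adj, exists_proj_hom_simple_ne_zero_iff 𝕜 hg hL]

omit 𝕜 [WeakInvolution B] in
lemma ne_zero_of_epi_to_simple {i j : B} {g : i ⟶ j} {L : Principal i j} (hL : Simple L)
    (p : proj g ⟶ L) [Epi p] : p ≠ 0 := fun h =>
  Simple.not_isZero L (IsZero.of_epi_eq_zero p h)

/-- The simple quotient of the projective object of an indecomposable 1-morphism exists and is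
unique. -/
theorem exists_unique_isSimpleQuotient {i j : B} (f : i ⟶ j) (hf : Indecomposable f) :
    ∃ L : Principal i j, IsSimpleQuotient f L ∧
      ∀ L' : Principal i j, IsSimpleQuotient f L' → Nonempty (L ≅ L') := by
  have := FiatCategory.finiteDimensional (𝕜 := 𝕜) (B := B) (i := i) (j := j)
  have := FiatCategory.isIdempotentComplete 𝕜 i j
  have := hasWeakKernels 𝕜 i j
  obtain ⟨G, hG⟩ := exists_additiveGenerator 𝕜 i j
  obtain ⟨L, hL, p, hp⟩ := exists_simple_quotient_freydProj 𝕜 hG hf.1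
  refine ⟨L, ⟨hL, p, hp⟩, ?_⟩
  rintro L' ⟨hL', p', hp'⟩
  have hP := isUnit_or_isNilpotent_end_freydProj 𝕜 hf
  exact nonempty_iso_of_local (P := freydProj f) hP p (ne_zero_of_epi_to_simple hL' p')

theorem not_isZero_act_iff_leL {i j k : B} (f : j ⟶ k) (g : i ⟶ j) (Lg : Principal i j)
    (hg : Indecomposable g) (hLg : IsSimpleQuotient g Lg) :
    ¬ IsZero ((act f).obj Lg) ↔ LeL (dual f) g := by
  constructor
  · intro h
    by_contra h'
    refine h ((IsZero.iff_id_eq_zero _).2 (freyd_hom_ext fun x θ => ?_))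
    have hz : ∀ φ : proj x ⟶ (act f).obj Lg, φ = 0 := fun φ => by
      by_contra hφ
      exact h' ⟨x, (exists_proj_hom_act_ne_zero_iff 𝕜 hg hLg f x).1 ⟨φ, hφ⟩⟩
    exact (hz (θ ≫ 𝟙 _)).trans (hz (θ ≫ 0)).symm
  · rintro ⟨x, hx⟩ h
    obtain ⟨φ, hφ⟩ := (exists_proj_hom_act_ne_zero_iff 𝕜 hg hLg f x).2 hx
    exact hφ (h.eq_of_tgt _ _)

/-- If some 1-morphism maps `M` to an object with a nonzero morphism from `P_x`, then so does an
indecomposable one. -/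
lemma exists_indecomposable_proj_hom_ne_zero {i j k : B} (x : i ⟶ k) (M : Principal i j)
    (f : j ⟶ k) (hf : ∃ φ : proj x ⟶ (act f).obj M, φ ≠ 0) :
    ∃ f' : j ⟶ k, Indecomposable f' ∧ ∃ φ : proj x ⟶ (act f').obj M, φ ≠ 0 := by
  have := FiatCategory.finiteDimensional (𝕜 := 𝕜) (B := B) (i := j) (j := k)
  revert hf
  refine indecomposable_induction 𝕜 (Q := fun f : j ⟶ k =>
    (∃ φ : proj x ⟶ (act f).obj M, φ ≠ 0) → ∃ f' : j ⟶ k, Indecomposable f' ∧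
      ∃ φ : proj x ⟶ (act f').obj M, φ ≠ 0) ?_ ?_ ?_ f
  · rintro f hf ⟨φ, hφ⟩
    exact absurd ((isZero_act_obj hf M).eq_of_tgt _ _) hφ
  · exact fun f hf h => ⟨f, hf, h⟩
  · rintro f f₁ f₂ ψ h₁ h₂ ⟨φ, hφ⟩
    -- The identity of `f M` is the sum of the two projectors, so a nonzero `φ` has a nonzero
    -- component in one summand.
    by_cases hφ₁ : φ ≫ actHom (ψ.hom ≫ biprod.fst) M = 0
    · by_cases hφ₂ : φ ≫ actHom (ψ.hom ≫ biprod.snd) M = 0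
      · refine absurd ?_ hφ
        have hid : 𝟙 f = (ψ.hom ≫ biprod.fst) ≫ biprod.inl ≫ ψ.inv +
            (ψ.hom ≫ biprod.snd) ≫ biprod.inr ≫ ψ.inv := by
          rw [← cancel_mono ψ.hom]
          ext <;> simp
        rw [← Category.comp_id φ, ← actHom_id, hid, actHom_add, actHom_comp (ψ.hom ≫ biprod.fst),
          actHom_comp (ψ.hom ≫ biprod.snd), Preadditive.comp_add, reassoc_of% hφ₁,
          reassoc_of% hφ₂, zero_comp, zero_comp, add_zero]
      · exact h₂ ⟨_, hφ₂⟩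
    · exact h₁ ⟨_, hφ₁⟩

theorem exists_multiplicity_act_ne_zero_of_leR {i j k : B} (g : i ⟶ j) (h : i ⟶ k)
    (Lg : Principal i j) (Lh : Principal i k) (hg : Indecomposable g) (hh : Indecomposable h)
    (hLg : IsSimpleQuotient g Lg) (hLh : IsSimpleQuotient h Lh) (hle : LeR h g) :
    ∃ f : j ⟶ k, Indecomposable f ∧ multiplicity ((act f).obj Lg) Lh ≠ 0 := by
  obtain ⟨x, hx⟩ := hle
  obtain ⟨f, hf, hφ⟩ := exists_indecomposable_proj_hom_ne_zero 𝕜 h Lg (dual x)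
    ((exists_proj_hom_act_dual_ne_zero_iff 𝕜 hg hLg x h).2 hx)
  exact ⟨f, hf, (multiplicity_simple_ne_zero_iff 𝕜 hh hLh _).2 hφ⟩

/-- Lifting `P_f ⟶ L_f` through `q` gives `f ≤_R g`. The transpose `L_g ⟶ h* L_f` of `q` is nonzero,
and preceding it by `P_g ⟶ L_g` gives `g ≤_R f`. -/
theorem memRightCell_of_epi {i j k : B} (f : i ⟶ k) (g : i ⟶ j) (h : j ⟶ k)
    (Lf : Principal i k) (Lg : Principal i j) (hf : Indecomposable f) (hg : Indecomposable g)
    (hLf : IsSimpleQuotient f Lf) (hLg : IsSimpleQuotient g Lg)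
    (q : (act h).obj Lg ⟶ Lf) [Epi q] : MemRightCell f g := by
  obtain ⟨hLf', p, hp⟩ := id hLf
  obtain ⟨hLg', p', hp'⟩ := id hLg
  constructor
  · refine ⟨dual h, (exists_proj_hom_act_ne_zero_iff 𝕜 hg hLg h f).1
      ⟨Projective.factorThru (P := freydProj f) p q, fun h0 => ?_⟩⟩
    have hfac := Projective.factorThru_comp (P := freydProj f) p q
    rw [h0, zero_comp] at hfac
    exact ne_zero_of_epi_to_simple hLf' p hfac.symm
  · obtain ⟨adj⟩ := nonempty_act_adjunction 𝕜 i h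
    refine ⟨h, (exists_proj_hom_act_dual_ne_zero_iff 𝕜 hf hLf h g).1
      ⟨p' ≫ adj.homEquiv _ _ q, fun h0 => ?_⟩⟩
    have h1 : adj.homEquiv _ _ q = 0 := by rw [← cancel_epi p', h0, comp_zero]
    have h2 : q = 0 := by
      rw [← (adj.homEquiv _ _).symm_apply_apply q, h1, adj.homEquiv_counit, Functor.map_zero,
        zero_comp]
    exact Simple.not_isZero Lf (IsZero.of_epi_eq_zero q h2)

/-- Here `P_f ⟶ L_f` is composed with `s`, and the transpose `h* L_f ⟶ L_g` is epi because `L_g` is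
simple, so `P_g ⟶ L_g` lifts through it. -/
theorem memRightCell_of_mono {i j k : B} (f : i ⟶ k) (g : i ⟶ j) (h : j ⟶ k)
    (Lf : Principal i k) (Lg : Principal i j) (hf : Indecomposable f) (hg : Indecomposable g)
    (hLf : IsSimpleQuotient f Lf) (hLg : IsSimpleQuotient g Lg)
    (s : Lf ⟶ (act h).obj Lg) [Mono s] : MemRightCell f g := by
  obtain ⟨hLf', p, hp⟩ := id hLf
  obtain ⟨hLg', p', hp'⟩ := id hLg
  constructor
  · refine ⟨dual h, (exists_proj_hom_act_ne_zero_iff 𝕜 hg hLg h f).1 ⟨p ≫ s, fun h0 => ?_⟩⟩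
    exact ne_zero_of_epi_to_simple hLf' p (by rw [← cancel_mono s, h0, zero_comp])
  · have := hasWeakKernels 𝕜 i j
    obtain ⟨adj⟩ := nonempty_act_dual_adjunction 𝕜 i h
    let q := (adj.homEquiv _ _).symm s
    have hq0 : q ≠ 0 := fun h0 => by
      have h1 : s = 0 := by
        rw [← (adj.homEquiv _ _).apply_symm_apply s]
        change adj.homEquiv _ _ q = 0
        rw [h0, adj.homEquiv_unit, Functor.map_zero, comp_zero]
      exact Simple.not_isZero Lf (IsZero.of_mono_eq_zero s h1)
    have hq : Epi q := epi_of_nonzero_to_simple hq0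
    refine ⟨h, (exists_proj_hom_act_dual_ne_zero_iff 𝕜 hf hLf h g).1
      ⟨Projective.factorThru (P := freydProj g) p' q, fun h0 => ?_⟩⟩
    have hfac := Projective.factorThru_comp (P := freydProj g) p' q
    rw [h0, zero_comp] at hfac
    exact ne_zero_of_epi_to_simple hLg' p' hfac.symm

/-- Adjunction and `f P_𝟙 ≅ P_f` reduce this to composition with `p` from `End L_f` to `Hom(P_f,
L_f)`: injective as `p` is epi, surjective as every morphism from `P_f` to a simple object factors
through `p`. -/
theorem nonempty_proj_id_hom_linearEquiv {i j : B} (f : i ⟶ j) (Lf : Principal i j)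
    (hf : Indecomposable f) (hLf : IsSimpleQuotient f Lf) :
    Nonempty ((proj (𝟙 i) ⟶ (act (dual f)).obj Lf) ≃ₗ[𝕜] (Lf ⟶ Lf)) := by
  have := FiatCategory.finiteDimensional (𝕜 := 𝕜) (B := B) (i := i) (j := j)
  have := FiatCategory.isIdempotentComplete 𝕜 i j
  have := hasWeakKernels 𝕜 i j
  obtain ⟨hL, p, hp⟩ := hLf
  obtain ⟨adj⟩ := nonempty_act_adjunction 𝕜 i f
  let κ : (act f).obj (proj (𝟙 i)) ≅ proj f :=
    actProj f (𝟙 i) ≪≫ (Preadditive.RightFreyd.functor (i ⟶ j)).mapIso (λ_ f)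
  let F : (Lf ⟶ Lf) →ₗ[𝕜] (proj (𝟙 i) ⟶ (act (dual f)).obj Lf) :=
    { toFun := fun φ => adj.homEquiv _ _ (κ.hom ≫ p ≫ φ)
      map_add' := fun φ ψ => by
        simp only [adj.homEquiv_unit, Preadditive.comp_add, Functor.map_add]
      map_smul' := fun c φ => by
        simp only [adj.homEquiv_unit, Linear.comp_smul, Functor.map_smul, RingHom.id_apply] }
  have hF : Function.Bijective F := by
    constructor
    · intro φ ψ h
      have h1 := (adj.homEquiv _ _).injective h
      rwa [cancel_epi, cancel_epi] at h1
    · intro θ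
      have hP := isUnit_or_isNilpotent_end_freydProj 𝕜 hf
      obtain ⟨t, ht⟩ := exists_comp_eq_of_local (P := freydProj f) hP p
        (κ.inv ≫ (adj.homEquiv _ _).symm θ)
      refine ⟨t, ?_⟩
      change adj.homEquiv _ _ (κ.hom ≫ p ≫ t) = θ
      rw [ht, Iso.hom_inv_id_assoc, Equiv.apply_symm_apply]
  exact ⟨(LinearEquiv.ofBijective F hF).symm⟩

end FiatCategory

end Fiat

end

/-! ### The main theorem. -/

open CategoryTheory CategoryTheory.Limits Fiat in
theorem proposition3 {𝕜 : Type*} [Field 𝕜] {B : Type u} [Bicategory.{w, v} B]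
    [AdditiveTwoCategory B] [LinearTwoCategory 𝕜 B] [WeakInvolution B] [FiatCategory 𝕜 B] :
    -- For indecomposable `f` the object `L_f` exists and is unique up to isomorphism.
    (∀ {i j : B} (f : i ⟶ j), Indecomposable f →
      ∃ L : Principal i j, IsSimpleQuotient f L ∧
        ∀ L' : Principal i j, IsSimpleQuotient f L' → Nonempty (L ≅ L')) ∧
    -- `f L_g ≠ 0` if and only if `f* ≤_L g`.
    (∀ {i j k : B} (f : j ⟶ k) (g : i ⟶ j) (Lg : Principal i j),
      Indecomposable f → Indecomposable g → IsSimpleQuotient g Lg →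
      (¬ IsZero ((act f).obj Lg) ↔ LeL (dual f) g)) ∧
    -- `[f L_g : L_h] ≠ 0` implies `h ≤_R g`.
    (∀ {i j k : B} (f : j ⟶ k) (g : i ⟶ j) (h : i ⟶ k)
      (Lg : Principal i j) (Lh : Principal i k),
      Indecomposable f → Indecomposable g → Indecomposable h →
      IsSimpleQuotient g Lg → IsSimpleQuotient h Lh →
      multiplicity ((act f).obj Lg) Lh ≠ 0 → LeR h g) ∧
    -- If `h ≤_R g`, then `[f L_g : L_h] ≠ 0` for some `f`.
    (∀ {i j k : B} (g : i ⟶ j) (h : i ⟶ k) (Lg : Principal i j) (Lh : Principal i k),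
      Indecomposable g → Indecomposable h →
      IsSimpleQuotient g Lg → IsSimpleQuotient h Lh → LeR h g →
      ∃ f : j ⟶ k, Indecomposable f ∧ multiplicity ((act f).obj Lg) Lh ≠ 0) ∧
    -- If `L_f` occurs in the top or in the socle of `h L_g`, then `f` is in the right cell of `g`.
    (∀ {i j k : B} (f : i ⟶ k) (g : i ⟶ j) (h : j ⟶ k)
      (Lf : Principal i k) (Lg : Principal i j),
      Indecomposable f → Indecomposable g → Indecomposable h →
      IsSimpleQuotient f Lf → IsSimpleQuotient g Lg →
      (OccursInTop Lf ((act h).obj Lg) ∨ OccursInSocle Lf ((act h).obj Lg)) →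
      MemRightCell f g) ∧
    -- There is a nonzero morphism from `P_{𝟙 i}` to `f* L_f`; the space of these morphisms is
    -- isomorphic to `End L_f`, hence it is one-dimensional if `𝕜` is algebraically closed; and
    -- `f* L_f ≠ 0`.
    (∀ {i j : B} (f : i ⟶ j) (Lf : Principal i j),
      Indecomposable f → IsSimpleQuotient f Lf →
      (∃ φ : proj (𝟙 i) ⟶ (act (dual f)).obj Lf, φ ≠ 0) ∧
      Nonempty ((proj (𝟙 i) ⟶ (act (dual f)).obj Lf) ≃ₗ[𝕜] (Lf ⟶ Lf)) ∧
      (IsAlgClosed 𝕜 → Module.finrank 𝕜 (proj (𝟙 i) ⟶ (act (dual f)).obj Lf) = 1) ∧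
      ¬ IsZero ((act (dual f)).obj Lf)) := by
  refine ⟨fun f hf => exists_unique_isSimpleQuotient 𝕜 f hf,
    fun f g Lg _ hg hLg => not_isZero_act_iff_leL 𝕜 f g Lg hg hLg,
    fun f g h Lg Lh _ hg hh hLg hLh hm => ⟨dual f, ?_⟩,
    fun g h Lg Lh hg hh hLg hLh hle =>
      exists_multiplicity_act_ne_zero_of_leR 𝕜 g h Lg Lh hg hh hLg hLh hle,
    fun {i j k} f g h Lf Lg hf hg _ hLf hLg hocc => ?_,
    fun {i j} f Lf hf hLf => ?_⟩
  · exact (exists_proj_hom_act_ne_zero_iff 𝕜 hg hLg f h).1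
      ((multiplicity_simple_ne_zero_iff 𝕜 hh hLh _).1 hm)
  · have := hLf.1
    rcases hocc with ⟨T, q, ⟨hq, -⟩, ⟨r⟩⟩ | ⟨T, s, ⟨hs, -⟩, ⟨r⟩⟩
    -- A summand of the top is a quotient of `h L_g`; dually, a summand of the socle is a subobject.
    · exact memRightCell_of_epi 𝕜 f g h Lf Lg hf hg hLf hLg (q ≫ r.r)
    · exact memRightCell_of_mono 𝕜 f g h Lf Lg hf hg hLf hLg (r.i ≫ s)
  · have := FiatCategory.finiteDimensional (𝕜 := 𝕜) (B := B) (i := i) (j := j)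
    have := hasWeakKernels 𝕜 i j
    have hL := hLf.1
    have := finiteDimensional_freyd_hom 𝕜 Lf Lf
    obtain ⟨e⟩ := nonempty_proj_id_hom_linearEquiv 𝕜 f Lf hf hLf
    have hφ : e.symm (𝟙 Lf) ≠ 0 := fun h => id_nonzero Lf (e.symm.map_eq_zero_iff.1 h)
    refine ⟨⟨_, hφ⟩, ⟨e⟩, fun _ => ?_, fun h => hφ (h.eq_of_tgt _ _)⟩
    rw [e.finrank_eq, finrank_endomorphism_simple_eq_one 𝕜 Lf]
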